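/- Let $\Theta\subset\mathbb{R}^{n}$ be convex and closed, let $c\in\mathbb{R}^n$, let $q$ be a random element of $\mathbb{Q}$ with law $\mu$, and let $f:\Theta\times\mathbb{Q}\to\mathbb{R}$ be convex in $\theta$ for every fixed $q$. For $q^{(1)},\dots,q^{(m)}\in\mathbb{Q}$, $m\ge 1$, the scenario problem is $$\min_{\theta\in\Theta}\ c^T\theta\quad\text{subject to } f(\theta,q^{(i)})\le 0,\ i=1,\dots,m ;$$ assume that whenever a scenario problem is feasible, it has exactly one optimal solution. Let $V(\theta)=\mu\{q: f(\theta,q)>0\}$. As usual, $f$ and the solutions of the scenario problems (as functions of the samples) are taken to be measurable. Fix $\varepsilon,\delta\in(0,1)$, $\alpha>0$ and an integer $k_t>1$. Let $N$ be the smallest integer $N\ge 0$ with $$\sum_{i=0}^{n}\binom{N}{i}\varepsilon^i(1-\varepsilon)^{N-i}\le\frac{\delta}{2},$$ and let $N_k$ $(1\le k\le k_t)$ and $M_k$ $(1\le k<k_t)$ be integers with $$N_k\ge N\frac{k}{k_t},\qquad M_k\ge\frac{\alpha\ln k+\ln\Big(\sum_{j=1}^{k_t-1}j^{-\alpha}\Big)+\ln\frac{2}{\delta}}{\ln\frac{1}{1-\varepsilon}}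 .$$ Consider the following algorithm, in which all samples drawn, in all steps and iterations, are independent with law $\mu$. At iteration $k=1,2,\dots$: draw $N_k$ design samples and consider the scenario problem that they define. If it is infeasible, stop and report infeasibility (no solution is returned). Otherwise let $\widehat\theta_{N_k}$ be its solution. If $k=k_t$, exit with $\theta_{\mathrm{sol}}=\widehat\theta_{N_k}$. If $k<k_t$, draw $M_k$ fresh validation samples; if $f(\widehat\theta_{N_k},\cdot)\le 0$ at all of them, exit with $\theta_{\mathrm{sol}}=\widehat\theta_{N_k}$; otherwise go on to iteration $k+1$. Then, with probability at least $1-\delta$, whenever the algorithm exits with a solution $\theta_{\mathrm{sol}}$ (at any iteration), this solution satisfies $V(\theta_{\mathrm{sol}})\le\varepsilon$; that is, the probability that the algorithm exits with some $\theta_{\mathrm{sol}}$ such that $V(\theta_{\mathrm{sol}})>\varepsilon$ is at most $\delta$. -/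

import Mathlib

open MeasureTheory ProbabilityTheory

noncomputable section

namespace SeqScenario

/-- The decision space `ℝⁿ`. -/
abbrev Vec (n : ℕ) : Type := EuclideanSpace ℝ (Fin n)

/-- Feasible set of the scenario problem with samples `q 0, …, q (N-1)`:
all `θ ∈ Θ` with `f θ (q i) ≤ 0` for every `i`. -/
def feasibleSet {n : ℕ} {Q : Type*} (Θ : Set (Vec n)) (f : Vec n → Q → ℝ) {N : ℕ}
    (q : Fin N → Q) : Set (Vec n) :=
  {θ | θ ∈ Θ ∧ ∀ i, f θ (q i) ≤ 0}

/-- `θ` is an optimal solution of the scenario problem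
`min cᵀθ` subject to `θ ∈ Θ` and `f θ (q i) ≤ 0` for every `i`. -/
def IsScenarioSolution {n : ℕ} {Q : Type*} (c : Vec n) (Θ : Set (Vec n)) (f : Vec n → Q → ℝ)
    {N : ℕ} (q : Fin N → Q) (θ : Vec n) : Prop :=
  θ ∈ feasibleSet Θ f q ∧ ∀ θ' ∈ feasibleSet Θ f q, inner ℝ c θ ≤ inner ℝ c θ'

/-- Convexity assumption: `Θ` is convex and closed, and `f` is convex in `θ ∈ Θ` for
every fixed `q`. -/
def ConvexityAssumption {n : ℕ} {Q : Type*} (Θ : Set (Vec n)) (f : Vec n → Q → ℝ) : Prop :=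
  Convex ℝ Θ ∧ IsClosed Θ ∧ ∀ q, ConvexOn ℝ Θ (fun θ => f θ q)

/-- Uniqueness assumption: every feasible scenario problem (with at least one sample)
attains its minimum at exactly one point. -/
def UniquenessAssumption {n : ℕ} {Q : Type*} (c : Vec n) (Θ : Set (Vec n))
    (f : Vec n → Q → ℝ) : Prop :=
  ∀ N : ℕ, 1 ≤ N → ∀ q : Fin N → Q, (feasibleSet Θ f q).Nonempty →
    ∃! θ, IsScenarioSolution c Θ f q θ

open Classical in
/-- The solution of the scenario problem; the value is `0` if there is none
(the algorithm never uses it in that case). -/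
def scenarioSolution {n : ℕ} {Q : Type*} (c : Vec n) (Θ : Set (Vec n)) (f : Vec n → Q → ℝ)
    {N : ℕ} (q : Fin N → Q) : Vec n :=
  if h : ∃ θ, IsScenarioSolution c Θ f q θ then h.choose else 0

/-- Probability of violation `V(θ) = Pr {q : f(θ, q) > 0}`. -/
def violationProb {n : ℕ} {Q : Type*} [MeasurableSpace Q] (μ : Measure Q) (f : Vec n → Q → ℝ)
    (θ : Vec n) : ℝ :=
  μ.real {q | 0 < f θ q}

/-- The indicator of constraint violation: `0` if `f θ q ≤ 0` and `1` otherwise. -/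
def violationIndicator {n : ℕ} {Q : Type*} (f : Vec n → Q → ℝ) (θ : Vec n) (q : Q) : ℕ :=
  if f θ q ≤ 0 then 0 else 1

/-- Binomial tail `∑_{i=0}^{n} (N choose i) ε^i (1-ε)^(N-i)`; the terms with `i > N` vanish
because of the binomial coefficient. -/
def binomialTail (n N : ℕ) (ε : ℝ) : ℝ :=
  ∑ i ∈ Finset.range (n + 1), (N.choose i : ℝ) * ε ^ i * (1 - ε) ^ (N - i)

/-- Finite hyperharmonic series `S_m(α) = ∑_{j=1}^{m} j^(-α)`. -/
def pSeries (m : ℕ) (α : ℝ) : ℝ :=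
  ∑ j ∈ Finset.Icc 1 m, (j : ℝ) ^ (-α)

/-- Lower bound on the number of validation samples at iteration `k`:
`(α ln k + ln S_{kt-1}(α) + ln (2/δ)) / ln (1/(1-ε))`. -/
def validationBound (ε δ α : ℝ) (kt k : ℕ) : ℝ :=
  (α * Real.log k + Real.log (pSeries (kt - 1) α) + Real.log (2 / δ)) / Real.log (1 / (1 - ε))

/-- Result of a run: either a reduced-size scenario problem was found to be infeasible at
iteration `k`, or the algorithm exited at iteration `k` with the solution `θ`. -/
inductive Outcome (n : ℕ) : Type
  | infeasible (k : ℕ) : Outcome n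
  | exit (k : ℕ) (θ : Vec n) : Outcome n

open Classical in
/-- The algorithm from iteration `k` on, with at most `kt` iterations. Iteration `k` uses the
design samples `qd k` and the validation samples `qv k`. The full run is `runFrom … 1`, for
which `kt ≤ k` happens exactly at the last iteration `k = kt`. -/
def runFrom {n : ℕ} {Q : Type*} (c : Vec n) (Θ : Set (Vec n)) (f : Vec n → Q → ℝ) (kt : ℕ)
    {Nk Mk : ℕ → ℕ} (qd : ∀ k, Fin (Nk k) → Q) (qv : ∀ k, Fin (Mk k) → Q) (k : ℕ) :
    Outcome n :=
  if ¬ (feasibleSet Θ f (qd k)).Nonempty then .infeasible k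
  else if kt ≤ k then .exit k (scenarioSolution c Θ f (qd k))
  else if ∀ i, violationIndicator f (scenarioSolution c Θ f (qd k)) (qv k i) = 0 then
    .exit k (scenarioSolution c Θ f (qd k))
  else runFrom c Θ f kt qd qv (k + 1)
termination_by kt - k
decreasing_by omega

/-- The sequential randomized algorithm with full constraint satisfaction. -/
def sequentialAlgorithm {n : ℕ} {Q : Type*} (c : Vec n) (Θ : Set (Vec n)) (f : Vec n → Q → ℝ)
    (kt : ℕ) {Nk Mk : ℕ → ℕ} (qd : ∀ k, Fin (Nk k) → Q) (qv : ∀ k, Fin (Mk k) → Q) :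
    Outcome n :=
  runFrom c Θ f kt qd qv 1

/-- Index type of all draws: the `i`-th design sample of iteration `k` is `⟨k, .inl i⟩`, the
`i`-th validation sample of iteration `k` is `⟨k, .inr i⟩`. -/
abbrev Draw (Nk Mk : ℕ → ℕ) : Type := (k : ℕ) × (Fin (Nk k) ⊕ Fin (Mk k))

/-- The random outcome of the algorithm when all its samples are the random variables `X`. -/
def algorithmOutcome {n : ℕ} {Q Ω : Type*} (c : Vec n) (Θ : Set (Vec n)) (f : Vec n → Q → ℝ)
    (kt : ℕ) {Nk Mk : ℕ → ℕ} (X : Draw Nk Mk → Ω → Q) (ω : Ω) : Outcome n :=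
  sequentialAlgorithm c Θ f kt (fun k (i : Fin (Nk k)) => X ⟨k, .inl i⟩ ω)
    (fun k (i : Fin (Mk k)) => X ⟨k, .inr i⟩ ω)

end SeqScenario

end

/-! The proof is a union bound over iterations (`measurable_and_real_runFrom_le`). A bad exit, one
with `V > ε`, before the last iteration requires a bad design solution to pass `M_k` fresh samples,
which has probability at most `(1 - ε) ^ M_k`; these terms sum to at most `δ / 2`. A bad exit at the
last iteration has probability at most the binomial tail for `N_{k_t} ≥ N` samples, again at most `δ
/ 2`.

The binomial bound (`pi_real_violation_le_binomialTail`) is obtained by finite counting. Draw `N +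
M` i.i.d. samples. By exchangeability, the probability that the solution for `N` of them violates at
least `k` of the other `M` is bounded by the largest possible fraction of `N`-subsets of `N + M`
fixed constraints whose solution violates at least `k` of all. By `card_solution_violations_le` this
is at most a hypergeometric tail: the fraction of `N`-subsets with at most `n` of the first `k + n`
elements. Take `k ≈ ε' M` with `ε' < ε`, let `M → ∞` (Chebyshev links empirical violations to `V`),
then let `ε' → ε`.

For the count, the solutions are compared with a penalized min-max problem of strictly convex
functions. It is LP-type of dimension `n + 1` by Helly's theorem, and small shifts make it
nondegenerate. After padding, each `N`-set then has a unique base of exactly `n + 1` elements. The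
numbers of bases with `j` blocked elements solve a triangular linear system that does not depend on
the problem (`HasUniqueBases.baseProfile_eq`), so they can be read off from the model in which the
base consists of the `n + 1` smallest elements. -/

noncomputable section

namespace SeqScenario

/-! ### Counting sets by their unique bases -/

open Finset in
lemma card_between_eq_choose {S : Type*} [Fintype S] [DecidableEq S] {d r : ℕ} {B V : Finset S}
    (hB : #B = d) (hBV : Disjoint B V) (hr : d ≤ r) :
    #{T ∈ powersetCard r (univ : Finset S) | B ⊆ T ∧ Disjoint T V}
      = (Fintype.card S - d - #V).choose (r - d) := by
  have hc : #(univ \ (B ∪ V)) = Fintype.card S - d - #V := by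
    rw [card_sdiff_of_subset (subset_univ _), card_union_of_disjoint hBV, hB, card_univ]
    omega
  rw [← hc, ← card_powersetCard]
  refine card_bij' (fun T _ => T \ B) (fun R _ => R ∪ B) ?_ ?_ ?_ ?_
  · intro T hT
    simp only [mem_filter, mem_powersetCard, subset_univ, true_and] at hT ⊢
    obtain ⟨h1, h2, h3⟩ := hT
    refine ⟨fun x hx => ?_, ?_⟩
    · simp only [mem_sdiff, mem_univ, true_and, mem_union, not_or] at hx ⊢
      exact ⟨hx.2, fun h => (disjoint_left.1 h3) hx.1 h⟩
    · rw [card_sdiff_of_subset h2, h1, hB]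
  · intro R hR
    simp only [mem_filter, mem_powersetCard, subset_univ, true_and] at hR ⊢
    obtain ⟨h1, h2⟩ := hR
    have hRB : Disjoint R B := disjoint_left.2 fun x hx hxB => by
      have := h1 hx
      simp [hxB] at this
    refine ⟨?_, subset_union_right, ?_⟩
    · rw [card_union_of_disjoint hRB, h2, hB]; omega
    · refine disjoint_union_left.2 ⟨disjoint_left.2 fun x hx hxV => ?_, hBV⟩
      have := h1 hx
      simp [hxV] at this
  · intro T hT
    simp only [mem_filter] at hT
    exact sdiff_union_of_subset hT.2.1
  · intro R hR
    have h1 := (mem_powersetCard.1 hR).1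
    refine union_sdiff_cancel_right (disjoint_left.2 fun x hx hxB => ?_)
    have := h1 hx
    simp [hxB] at this

/-- Every set with at least `d` elements contains exactly one `d`-set `B` with no element of
the set in `U B`. -/
def HasUniqueBases {S : Type*} (d : ℕ) (U : Finset S → Finset S) : Prop :=
  ∀ T : Finset S, d ≤ T.card → ∃! B, B ⊆ T ∧ B.card = d ∧ Disjoint T (U B)

open Finset in
lemma HasUniqueBases.disjoint {S : Type*} {d : ℕ} {U : Finset S → Finset S}
    (hU : HasUniqueBases d U) {B : Finset S} (hB : #B = d) : Disjoint B (U B) := by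
  obtain ⟨B', ⟨h1, h2, h3⟩, -⟩ := hU B hB.ge
  rwa [eq_of_subset_of_card_le h1 (by omega)] at h3

/-- Number of `d`-sets `B` with `j` elements in `U B`. -/
def baseProfile {S : Type*} [Fintype S] (d : ℕ) (U : Finset S → Finset S) (j : ℕ) : ℕ :=
  ((Finset.powersetCard d (Finset.univ : Finset S)).filter fun B => (U B).card = j).card

section Counting

open Finset

variable {S : Type*} [Fintype S] [DecidableEq S] {d : ℕ} {U : Finset S → Finset S}

open Classical in
-- Uniqueness of bases partitions the `r`-sets by their base. Those with base `B` arise by choosing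
-- the other `r - d` elements outside `B ∪ U B`, so only the size of `U B` matters.
lemma HasUniqueBases.card_filter_le_card (hU : HasUniqueBases d U) (k : ℕ) {r : ℕ} (hr : d ≤ r) :
    #{T ∈ powersetCard r (univ : Finset S) |
        ∃ B, B ⊆ T ∧ #B = d ∧ Disjoint T (U B) ∧ k ≤ #(U B)} =
      ∑ j ∈ range (Fintype.card S - d + 1),
        if k ≤ j then baseProfile d U j * (Fintype.card S - d - j).choose (r - d) else 0 := by
  have h1 : {T ∈ powersetCard r (univ : Finset S) |
        ∃ B, B ⊆ T ∧ #B = d ∧ Disjoint T (U B) ∧ k ≤ #(U B)} =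
      ({B ∈ powersetCard d (univ : Finset S) | k ≤ #(U B)}).biUnion fun B =>
        {T ∈ powersetCard r (univ : Finset S) | B ⊆ T ∧ Disjoint T (U B)} := by
    ext T
    simp only [mem_filter, mem_powersetCard, subset_univ, true_and, mem_biUnion]
    constructor
    · rintro ⟨h, B, h2, h3, h4, h5⟩
      exact ⟨B, ⟨h3, h5⟩, h, h2, h4⟩
    · rintro ⟨B, ⟨h3, h5⟩, h, h2, h4⟩
      exact ⟨h, B, h2, h3, h4, h5⟩
  rw [h1, card_biUnion]
  · have h2 : ∀ B ∈ ({B ∈ powersetCard d (univ : Finset S) | k ≤ #(U B)}),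
        #{T ∈ powersetCard r (univ : Finset S) | B ⊆ T ∧ Disjoint T (U B)} =
          (Fintype.card S - d - #(U B)).choose (r - d) := by
      intro B hB
      simp only [mem_filter, mem_powersetCard, subset_univ, true_and] at hB
      exact card_between_eq_choose hB.1 (hU.disjoint hB.1) hr
    rw [sum_congr rfl h2]
    have hmaps : ∀ B ∈ ({B ∈ powersetCard d (univ : Finset S) | k ≤ #(U B)}),
        #(U B) ∈ range (Fintype.card S - d + 1) := by
      intro B hB
      simp only [mem_filter, mem_powersetCard, subset_univ, true_and] at hB
      have := card_union_of_disjoint (hU.disjoint hB.1)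
      have h3 := card_le_univ (B ∪ U B)
      rw [mem_range]
      omega
    rw [← sum_fiberwise_of_maps_to hmaps]
    refine sum_congr rfl fun j _ => ?_
    rw [sum_congr rfl (g := fun _ => (Fintype.card S - d - j).choose (r - d))]
    · rw [sum_const, smul_eq_mul]
      split_ifs with hk
      · congr 2
        ext B
        simp only [mem_filter, mem_powersetCard, subset_univ, true_and]
        constructor
        · rintro ⟨⟨h, -⟩, h'⟩; exact ⟨h, h'⟩
        · rintro ⟨h, h'⟩; exact ⟨⟨h, h' ▸ hk⟩, h'⟩
      · rw [mul_eq_zero]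
        left
        rw [card_eq_zero, filter_eq_empty_iff]
        intro B hB h
        simp only [mem_filter] at hB
        omega
    · intro B hB
      rw [(mem_filter.1 hB).2]
  · intro B hB C hC hBC
    refine disjoint_left.2 fun T hT hT' => hBC ?_
    simp only [coe_filter, mem_powersetCard, subset_univ, true_and, Set.mem_ofPred_eq] at hB hC
    simp only [mem_filter, mem_powersetCard, subset_univ, true_and] at hT hT'
    exact (hU T (hT.1 ▸ hr)).unique ⟨hT.2.1, hB.1, hT.2.2⟩ ⟨hT'.2.1, hC.1, hT'.2.2⟩

/-- The case `k = 0`, where every `r`-set is counted once: one linear equation on the profile for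
each `r`. -/
lemma HasUniqueBases.sum_baseProfile (hU : HasUniqueBases d U) {r : ℕ} (hr : d ≤ r) :
    ∑ j ∈ range (Fintype.card S - d + 1),
        baseProfile d U j * (Fintype.card S - d - j).choose (r - d) =
      (Fintype.card S).choose r := by
  classical
  have := hU.card_filter_le_card 0 hr
  simp only [zero_le, and_true, if_true] at this
  rw [← this, filter_true_of_mem, card_powersetCard, card_univ]
  intro T hT
  obtain ⟨B, hB, -⟩ := hU T (by rw [(mem_powersetCard.1 hT).2]; exact hr)
  exact ⟨B, hB⟩

/-- The equation for `r = M - j + d` involves only profile entries up to `j`, and entry `j` has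
coefficient `1`. The system is triangular and its data are `d` and the size of `S` alone. -/
lemma HasUniqueBases.baseProfile_eq {U' : Finset S → Finset S} (hU : HasUniqueBases d U)
    (hU' : HasUniqueBases d U') {j : ℕ} (hj : j ≤ Fintype.card S - d) :
    baseProfile d U j = baseProfile d U' j := by
  induction j using Nat.strong_induction_on with
  | _ j ih =>
    set M := Fintype.card S - d with hM
    have key : ∀ V : Finset S → Finset S, HasUniqueBases d V →
        ∑ i ∈ range j, baseProfile d V i * (M - i).choose (M - j) + baseProfile d V j =
          (Fintype.card S).choose (M - j + d) := by
      intro V hV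
      have h := hV.sum_baseProfile (r := M - j + d) (by omega)
      rw [← h, ← hM, Nat.add_sub_cancel,
        ← sum_subset (range_subset_range.2 (by omega : j + 1 ≤ M + 1)), sum_range_succ,
        Nat.choose_self, mul_one]
      intro i hi hi'
      rw [mem_range] at hi hi'
      rw [Nat.choose_eq_zero_of_lt (by omega), mul_zero]
    have h1 := key U hU
    have h2 := key U' hU'
    rw [sum_congr rfl fun i hi => by
      rw [ih i (mem_range.1 hi) ((mem_range.1 hi).le.trans hj)]] at h1
    omega

open Classical in
lemma HasUniqueBases.card_filter_le_card_eq {U' : Finset S → Finset S} (hU : HasUniqueBases d U)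
    (hU' : HasUniqueBases d U') (k : ℕ) {r : ℕ} (hr : d ≤ r) :
    #{T ∈ powersetCard r (univ : Finset S) |
        ∃ B, B ⊆ T ∧ #B = d ∧ Disjoint T (U B) ∧ k ≤ #(U B)} =
    #{T ∈ powersetCard r (univ : Finset S) |
        ∃ B, B ⊆ T ∧ #B = d ∧ Disjoint T (U' B) ∧ k ≤ #(U' B)} := by
  rw [hU.card_filter_le_card k hr, hU'.card_filter_le_card k hr]
  refine sum_congr rfl fun j hj => ?_
  rw [hU.baseProfile_eq hU' (by rw [mem_range] at hj; omega)]

end Counting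

/-! ### Padding bases to full size, and the model problem -/

section Padding

open Finset

variable {S : Type*} [LinearOrder S]

lemma exists_subset_card_eq_forall_lt (R : Finset S) {k : ℕ} (hk : k ≤ #R) :
    ∃ A ⊆ R, #A = k ∧ ∀ x ∈ R \ A, ∀ y ∈ A, y < x := by
  induction k with
  | zero => exact ⟨∅, by simp⟩
  | succ k ih =>
    obtain ⟨A, hA, hc, h⟩ := ih (by omega)
    have hne : (R \ A).Nonempty := by
      rw [← card_pos, card_sdiff_of_subset hA]; omega
    have hm := min'_mem _ hne
    refine ⟨insert ((R \ A).min' hne) A, ?_, ?_, ?_⟩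
    · exact insert_subset (mem_sdiff.1 hm).1 hA
    · rw [card_insert_of_notMem (mem_sdiff.1 hm).2, hc]
    · intro x hx y hy
      simp only [mem_sdiff, mem_insert, not_or] at hx
      have hxR : x ∈ R \ A := mem_sdiff.2 ⟨hx.1, hx.2.2⟩
      rcases mem_insert.1 hy with rfl | hy
      · exact lt_of_le_of_ne (min'_le _ _ hxR) (Ne.symm hx.2.1)
      · exact h x hxR y hy

/-- Bases `β T` of size at most `d`, extended by smallest elements, are unique. -/
lemma existsUnique_padding {d : ℕ} {β T : Finset S} (hβ : β ⊆ T) (hβd : #β ≤ d) (hd : d ≤ #T) :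
    ∃! B, B ⊆ T ∧ #B = d ∧ β ⊆ B ∧ ∀ x ∈ T \ B, ∀ y ∈ B \ β, y < x := by
  obtain ⟨A, hA, hc, h⟩ := exists_subset_card_eq_forall_lt (T \ β) (k := d - #β)
    (by rw [card_sdiff_of_subset hβ]; omega)
  have hdis : Disjoint A β := disjoint_left.2 fun x hx => (mem_sdiff.1 (hA hx)).2
  refine ⟨A ∪ β, ⟨union_subset (hA.trans sdiff_subset) hβ, ?_, subset_union_right, ?_⟩, ?_⟩
  · rw [card_union_of_disjoint hdis]; omega
  · intro x hx y hy
    simp only [mem_sdiff, mem_union, not_or] at hx hy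
    refine h x ?_ y (by tauto)
    simp only [mem_sdiff]; tauto
  · rintro B ⟨hB, hBc, hβB, hBlt⟩
    by_contra hne
    have hcard : #B = #(A ∪ β) := by rw [card_union_of_disjoint hdis]; omega
    -- Two distinct candidates of equal size each contain a padding element that the other lacks;
    -- each of the two elements would have to be below the other.
    obtain ⟨b, hb, hb'⟩ := not_subset.1 fun hs => hne (eq_of_subset_of_card_le hs hcard.ge)
    obtain ⟨b', hb2, hb2'⟩ := not_subset.1 fun hs => hne (eq_of_subset_of_card_le hs hcard.le).symm
    simp only [mem_union, not_or] at hb' hb2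
    have hb2β : b' ∉ β := fun hh => hb2' (hβB hh)
    have hb2A : b' ∈ A := by tauto
    have h1 : b' < b := h b (by simp only [mem_sdiff]; exact ⟨⟨hB hb, hb'.2⟩, hb'.1⟩) b' hb2A
    have h2 : b < b' := hBlt b' (mem_sdiff.2 ⟨(mem_sdiff.1 (hA hb2A)).1, hb2'⟩) b
      (mem_sdiff.2 ⟨hb, hb'.2⟩)
    exact lt_asymm h1 h2

/-- Elements outside `B` below some element of `B`. -/
def lowerGap [Fintype S] (B : Finset S) : Finset S := {x | x ∉ B ∧ ∃ y ∈ B, x < y}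

/-- Padding of the empty base: the base of `T` consists of its `d` smallest elements. -/
lemma hasUniqueBases_lowerGap [Fintype S] (d : ℕ) : HasUniqueBases d (lowerGap (S := S)) := by
  intro T hT
  have := existsUnique_padding (empty_subset T) (by simp) hT
  refine (existsUnique_congr fun B => ?_).1 this
  refine and_congr_right fun hBT => and_congr_right fun _ => ?_
  simp only [empty_subset, sdiff_empty, true_and, lowerGap]
  rw [disjoint_left]
  constructor
  · intro h x hx hx'
    simp only [mem_filter, mem_univ, true_and] at hx'
    obtain ⟨h1, y, hy, hlt⟩ := hx'
    exact lt_asymm hlt (h x (mem_sdiff.2 ⟨hx, h1⟩) y hy)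
  · intro h x hx y hy
    rw [mem_sdiff] at hx
    have := h hx.1
    simp only [mem_filter, mem_univ, true_and, not_and, not_exists, not_lt] at this
    exact lt_of_le_of_ne (this hx.2 y hy) fun he => hx.2 (he ▸ hy)

end Padding

/-! ### Violators in nondegenerate LP-type problems -/

/-- A real-valued LP-type problem of combinatorial dimension at most `d` in which bases are
determined by their values. -/
structure IsNondegenerateLPType {S : Type*} [DecidableEq S] (d : ℕ) (w : Finset S → ℝ) : Prop where
  mono : Monotone w
  locality : ∀ B T, B ⊆ T → (∀ x ∈ T, w (insert x B) = w B) → w T = w B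
  exists_basis : ∀ T, ∃ B ⊆ T, B.card ≤ d ∧ w B = w T
  basis_unique : ∀ B C, (∀ i ∈ B, w (B.erase i) < w B) → (∀ i ∈ C, w (C.erase i) < w C) →
    w B = w C → B = C

section LPType

open Finset

variable {d : ℕ}

/-- A subset of `T` of least size with value `w T` has only essential elements; nondegeneracy then
makes it a function of the value `w T`. -/
lemma IsNondegenerateLPType.exists_basisMap {S : Type*} [DecidableEq S] {w : Finset S → ℝ}
    (hw : IsNondegenerateLPType d w) :
    ∃ β : Finset S → Finset S, ∀ T, β T ⊆ T ∧ #(β T) ≤ d ∧ w (β T) = w T ∧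
      ∀ T', w T' = w T → β T' = β T := by
  have h : ∀ T : Finset S, ∃ B ⊆ T, #B ≤ d ∧ w B = w T ∧ ∀ i ∈ B, w (B.erase i) < w B := by
    intro T
    have hex : ∃ k, ∃ B ⊆ T, #B = k ∧ w B = w T := ⟨_, T, Subset.rfl, rfl, rfl⟩
    classical
    obtain ⟨B, hB, hBc, hBw⟩ := Nat.find_spec hex
    refine ⟨B, hB, ?_, hBw, fun i hi => ?_⟩
    · obtain ⟨C, hC, hCd, hCw⟩ := hw.exists_basis T
      rw [hBc]
      exact (Nat.find_min' hex ⟨C, hC, rfl, hCw⟩).trans hCd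
    · refine lt_of_le_of_ne (hw.mono (erase_subset _ _)) fun he => ?_
      have := Nat.find_min' hex ⟨B.erase i, (erase_subset _ _).trans hB, rfl, he.trans hBw⟩
      have h2 := card_erase_lt_of_mem hi
      omega
  choose β h1 h2 h3 h4 using h
  exact ⟨β, fun T => ⟨h1 T, h2 T, h3 T, fun T' hT' =>
    hw.basis_unique _ _ (h4 T') (h4 T) (by rw [h3, h3, hT'])⟩⟩

/-- In a nondegenerate LP-type problem of dimension `d`, the number of `N`-sets with at least `k`
violators is at most the number of `N`-sets with fewer than `d` elements among the first
`k + d - 1`. -/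
theorem IsNondegenerateLPType.card_violators_le {m : ℕ} {w : Finset (Fin m) → ℝ}
    (hw : IsNondegenerateLPType d w) {N k : ℕ} (hd : 0 < d) (hN : d ≤ N) :
    #{T ∈ powersetCard N (univ : Finset (Fin m)) | k ≤ #{x | w T < w (insert x T)}} ≤
      #{T ∈ powersetCard N (univ : Finset (Fin m)) | #{x ∈ T | x.val < k + d - 1} < d} := by
  classical
  obtain ⟨β, hβ⟩ := hw.exists_basisMap
  -- An element blocks `B` as a padded base if it raises the value or precedes a padding element, so
  -- should have been used as padding itself.
  set U : Finset (Fin m) → Finset (Fin m) := fun B =>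
    {x | x ∉ B ∧ (w B < w (insert x B) ∨ ∃ y ∈ B \ β B, x < y)} with hUdef
  have hiff : ∀ T B : Finset (Fin m), B ⊆ T →
      ((β T ⊆ B ∧ ∀ x ∈ T \ B, ∀ y ∈ B \ β T, y < x) ↔ Disjoint T (U B)) := by
    intro T B hBT
    obtain ⟨b1, b2, b3, b4⟩ := hβ T
    constructor
    · rintro ⟨h1, h2⟩
      have hwBT : w B = w T := le_antisymm (hw.mono hBT) (b3 ▸ hw.mono h1)
      refine disjoint_left.2 fun x hx hxU => ?_
      simp only [hUdef, mem_filter, mem_univ, true_and] at hxU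
      obtain ⟨hxB, h | ⟨y, hy, hlt⟩⟩ := hxU
      · exact absurd (hw.mono (insert_subset hx hBT)) (not_le.2 (hwBT ▸ h))
      · rw [b4 B hwBT] at hy
        exact lt_asymm hlt (h2 x (mem_sdiff.2 ⟨hx, hxB⟩) y hy)
    · intro h
      have hwBT : w T = w B := by
        refine hw.locality B T hBT fun x hx => ?_
        by_cases hxB : x ∈ B
        · rw [insert_eq_of_mem hxB]
        · refine le_antisymm (not_lt.1 fun hlt => (disjoint_left.1 h) hx ?_)
            (hw.mono (subset_insert _ _))
          simp only [hUdef, mem_filter, mem_univ, true_and]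
          exact ⟨hxB, Or.inl hlt⟩
      have hβ' := b4 B hwBT.symm
      refine ⟨hβ' ▸ (hβ B).1, fun x hx y hy => ?_⟩
      rw [mem_sdiff] at hx
      by_contra hlt
      refine (disjoint_left.1 h) hx.1 ?_
      simp only [hUdef, mem_filter, mem_univ, true_and]
      refine ⟨hx.2, Or.inr ⟨y, hβ' ▸ hy, lt_of_le_of_ne (not_lt.1 hlt) ?_⟩⟩
      rintro rfl
      exact hx.2 (mem_sdiff.1 hy).1
  have hU : HasUniqueBases d U := by
    intro T hT
    refine (existsUnique_congr fun B => ?_).1 (existsUnique_padding (hβ T).1 (hβ T).2.1 hT)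
    exact and_congr_right fun hBT => and_congr_right fun _ => hiff T B hBT
  calc _ ≤ #{T ∈ powersetCard N (univ : Finset (Fin m)) |
        ∃ B, B ⊆ T ∧ #B = d ∧ Disjoint T (U B) ∧ k ≤ #(U B)} := by
        refine card_le_card fun T hT => ?_
        simp only [mem_filter, mem_powersetCard, subset_univ, true_and] at hT ⊢
        refine ⟨hT.1, ?_⟩
        obtain ⟨B, ⟨hBT, hBd, hBU⟩, -⟩ := hU T (hT.1 ▸ hN)
        refine ⟨B, hBT, hBd, hBU, hT.2.trans (card_le_card fun x hx => ?_)⟩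
        obtain ⟨h1, -⟩ := (hiff T B hBT).2 hBU
        have hwBT : w B = w T := le_antisymm (hw.mono hBT) ((hβ T).2.2.1 ▸ hw.mono h1)
        simp only [mem_filter, mem_univ, true_and] at hx
        simp only [hUdef, mem_filter, mem_univ, true_and]
        refine ⟨fun hxB => ?_, Or.inl (not_le.1 fun hle => ?_)⟩
        · rw [insert_eq_of_mem (hBT hxB)] at hx
          exact lt_irrefl _ hx
        · refine hx.ne' ?_
          rw [← hwBT]
          refine hw.locality B _ (hBT.trans (subset_insert _ _)) fun y hy => ?_
          refine le_antisymm ?_ (hw.mono (subset_insert _ _))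
          rcases mem_insert.1 hy with rfl | hy
          · exact hle
          · rw [hwBT]
            exact hw.mono (insert_subset hy hBT)
    _ = _ := hU.card_filter_le_card_eq (hasUniqueBases_lowerGap d) k hN
    _ ≤ _ := by
        refine card_le_card fun T hT => ?_
        simp only [mem_filter, mem_powersetCard, subset_univ, true_and] at hT ⊢
        refine ⟨hT.1, ?_⟩
        obtain ⟨B, hBT, hBd, hdis, hk⟩ := hT.2
        have hne : B.Nonempty := by rw [← card_pos]; omega
        have hsub : ∀ x, x < B.max' hne → x ∈ T → x ∈ B.erase (B.max' hne) := by
          intro x hx hxT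
          refine mem_erase.2 ⟨hx.ne, by_contra fun hxB => (disjoint_left.1 hdis) hxT ?_⟩
          simp only [lowerGap, mem_filter, mem_univ, true_and]
          exact ⟨hxB, _, max'_mem _ hne, hx⟩
        have hcov : B ∪ lowerGap B ⊆ Iic (B.max' hne) := by
          intro x hx
          rw [mem_Iic]
          rcases mem_union.1 hx with hx | hx
          · exact le_max' _ _ hx
          · simp only [lowerGap, mem_filter, mem_univ, true_and] at hx
            obtain ⟨-, y, hy, hlt⟩ := hx
            exact hlt.le.trans (le_max' _ _ hy)
        -- At least `d + k` elements lie at or below the maximum of `B`, so its index is at least `k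
        -- + d - 1`. Elements of `T` with smaller index are in `B` but are not its maximum, hence
        -- number fewer than `d`.
        have hmax := card_le_card hcov
        rw [card_union_of_disjoint ((hasUniqueBases_lowerGap d).disjoint hBd), Fin.card_Iic] at hmax
        calc #{x ∈ T | x.val < k + d - 1} ≤ #(B.erase (B.max' hne)) := by
              refine card_le_card fun x hx => ?_
              rw [mem_filter] at hx
              refine hsub x (Fin.lt_def.2 ?_) hx.1
              omega
          _ < d := by rw [← hBd]; exact card_erase_lt_of_mem (max'_mem _ hne)

end LPType

/-! ### Generic small perturbations -/

section Perturbation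

open Finset

/-- Finitely many conditions, each of which, along some coordinate, fails for at most one value,
can be avoided by arbitrarily small perturbations. -/
lemma exists_small_avoiding {S J : Type*} [Fintype S] [DecidableEq S] [Fintype J]
    (i : J → S) (bad : J → (S → ℝ) → Prop)
    (hbad : ∀ j η a b, bad j (Function.update η (i j) a) → bad j (Function.update η (i j) b) →
      a = b) {τ : ℝ} (hτ : 0 < τ) :
    ∃ η : S → ℝ, (∀ s, 0 ≤ η s ∧ η s ≤ τ) ∧ ∀ j, ¬ bad j η := by
  classical
  -- On a grid with `L` values per coordinate, each condition fails at no more than a fraction `1 /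
  -- L` of the points: one per line in its direction. With `L` above the number of conditions, some
  -- grid point survives.
  set L := Fintype.card J + 1 with hL
  have hLpos : (0 : ℝ) < L := by positivity
  let e : (S → Fin L) → S → ℝ := fun c s => τ * (c s : ℕ) / L
  have he : ∀ c s a, e (Function.update c s a) = Function.update (e c) s (τ * (a : ℕ) / L) := by
    intro c s a
    ext t
    by_cases h : t = s
    · subst h; simp [e]
    · simp [e, h]
  by_contra! hcon
  have hall : ∀ c : S → Fin L, ∃ j, bad j (e c) := by
    intro c
    refine hcon (e c) fun s => ⟨by positivity, ?_⟩
    rw [div_le_iff₀ hLpos]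
    gcongr
    exact (c s).is_lt.le
  have hcard : ∀ j, Fintype.card {c : S → Fin L // bad j (e c)} * L ≤
      Fintype.card (S → Fin L) := by
    intro j
    have hprod : Fintype.card {c : S → Fin L // bad j (e c)} * L =
        Fintype.card ({c : S → Fin L // bad j (e c)} × Fin L) := by
      rw [Fintype.card_prod, Fintype.card_fin]
    rw [hprod]
    refine Fintype.card_le_of_injective
      (fun p : {c : S → Fin L // bad j (e c)} × Fin L => Function.update p.1.1 (i j) p.2) ?_
    rintro ⟨⟨c, hc⟩, a⟩ ⟨⟨c', hc'⟩, a'⟩ h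
    dsimp only at h
    have ha : a = a' := by simpa using congrFun h (i j)
    have hcc : c = Function.update c' (i j) (c (i j)) := by
      ext t
      by_cases ht : t = i j
      · subst ht; simp
      · have := congrFun h t
        simp only [Function.update_of_ne ht] at this ⊢
        rw [this]
    have h1 : bad j (Function.update (e c') (i j) (τ * (c (i j) : ℕ) / L)) := by
      rw [← he, ← hcc]; exact hc
    have h2 : bad j (Function.update (e c') (i j) (τ * (c' (i j) : ℕ) / L)) := by
      rw [← he, Function.update_eq_self]; exact hc'
    have h3 := hbad _ _ _ _ h1 h2
    have h4 : c (i j) = c' (i j) := by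
      rw [div_left_inj' hLpos.ne', mul_right_inj' hτ.ne'] at h3
      exact Fin.ext (by exact_mod_cast h3)
    rw [h4, Function.update_eq_self] at hcc
    simp [hcc, ha]
  have hsum : Fintype.card (S → Fin L) ≤ ∑ j, Fintype.card {c : S → Fin L // bad j (e c)} := by
    rw [← Fintype.card_sigma]
    choose jj hjj using hall
    refine Fintype.card_le_of_injective
      (fun c => (⟨jj c, c, hjj c⟩ : (j : J) × {c : S → Fin L // bad j (e c)})) ?_
    intro c c' h
    rw [Sigma.mk.injEq] at h
    obtain ⟨h1, h2⟩ := h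
    have : ∀ j j' (x : {c : S → Fin L // bad j (e c)}) (y : {c : S → Fin L // bad j' (e c)}),
        j = j' → HEq x y → x.1 = y.1 := by
      rintro j _ x y rfl hxy
      rw [eq_of_heq hxy]
    exact this _ _ _ _ h1 h2
  have hpos : 0 < Fintype.card (S → Fin L) := Fintype.card_pos
  have h1 : Fintype.card (S → Fin L) * L ≤ Fintype.card J * Fintype.card (S → Fin L) := by
    calc _ ≤ (∑ j, Fintype.card {c : S → Fin L // bad j (e c)}) * L := by gcongr
      _ = ∑ j, Fintype.card {c : S → Fin L // bad j (e c)} * L := sum_mul _ _ _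
      _ ≤ ∑ _j : J, Fintype.card (S → Fin L) := sum_le_sum fun j _ => hcard j
      _ = _ := by rw [sum_const, card_univ, smul_eq_mul]
  rw [mul_comm, Nat.mul_le_mul_right_iff hpos] at h1
  omega

end Perturbation

/-! ### Min-max problems of strictly convex functions -/

section MinMax

open Finset

variable {E S : Type*}

/-- Pointwise maximum of `g` and of the functions `ψ i`, `i ∈ T`. -/
def maxOver (g : E → ℝ) (ψ : S → E → ℝ) (T : Finset S) (z : E) : ℝ :=
  T.fold max (g z) fun i => ψ i z

/-- The minimum over `D` of `maxOver g ψ T`. -/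
def minMax (D : Set E) (g : E → ℝ) (ψ : S → E → ℝ) (T : Finset S) : ℝ :=
  sInf (maxOver g ψ T '' D)

lemma maxOver_le_iff {g : E → ℝ} {ψ : S → E → ℝ} {T : Finset S} {z : E} {a : ℝ} :
    maxOver g ψ T z ≤ a ↔ g z ≤ a ∧ ∀ i ∈ T, ψ i z ≤ a := fold_max_le _

lemma maxOver_lt_iff {g : E → ℝ} {ψ : S → E → ℝ} {T : Finset S} {z : E} {a : ℝ} :
    maxOver g ψ T z < a ↔ g z < a ∧ ∀ i ∈ T, ψ i z < a := fold_max_lt _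

lemma maxOver_mono {g : E → ℝ} {ψ : S → E → ℝ} {T T' : Finset S} (h : T ⊆ T') (z : E) :
    maxOver g ψ T z ≤ maxOver g ψ T' z := by
  have := maxOver_le_iff.1 (le_refl (maxOver g ψ T' z))
  exact maxOver_le_iff.2 ⟨this.1, fun i hi => this.2 i (h hi)⟩

variable [NormedAddCommGroup E] [NormedSpace ℝ E]

/-- Minimization over a compact convex set of maxima of continuous strictly convex functions. -/
structure IsMinMaxProblem (D : Set E) (g : E → ℝ) (ψ : S → E → ℝ) : Prop where
  isCompact : IsCompact D
  nonempty : D.Nonempty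
  continuousOn_base : ContinuousOn g D
  strictConvexOn_base : StrictConvexOn ℝ D g
  continuousOn : ∀ i, ContinuousOn (ψ i) D
  strictConvexOn : ∀ i, StrictConvexOn ℝ D (ψ i)

namespace IsMinMaxProblem

variable {D : Set E} {g : E → ℝ} {ψ : S → E → ℝ}

lemma continuousOn_maxOver (h : IsMinMaxProblem D g ψ) (T : Finset S) :
    ContinuousOn (maxOver g ψ T) D := by
  classical
  induction T using Finset.induction_on with
  | empty => exact h.continuousOn_base
  | insert i T hi ih =>
    have : maxOver g ψ (insert i T) = fun z => max (ψ i z) (maxOver g ψ T z) := by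
      funext z; exact fold_insert hi
    rw [this]
    exact ContinuousOn.sup (h.continuousOn i) ih

lemma strictConvexOn_maxOver (h : IsMinMaxProblem D g ψ) (T : Finset S) :
    StrictConvexOn ℝ D (maxOver g ψ T) := by
  classical
  induction T using Finset.induction_on with
  | empty => exact h.strictConvexOn_base
  | insert i T hi ih =>
    have : maxOver g ψ (insert i T) = fun z => max (ψ i z) (maxOver g ψ T z) := by
      funext z; exact fold_insert hi
    rw [this]
    exact (h.strictConvexOn i).sup ih

lemma bddBelow (h : IsMinMaxProblem D g ψ) (T : Finset S) :
    BddBelow (maxOver g ψ T '' D) :=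
  (h.isCompact.image_of_continuousOn (h.continuousOn_maxOver T)).bddBelow

lemma minMax_le (h : IsMinMaxProblem D g ψ) (T : Finset S) {z : E} (hz : z ∈ D) :
    minMax D g ψ T ≤ maxOver g ψ T z :=
  csInf_le (h.bddBelow T) ⟨z, hz, rfl⟩

lemma exists_eq_minMax (h : IsMinMaxProblem D g ψ) (T : Finset S) :
    ∃ z ∈ D, maxOver g ψ T z = minMax D g ψ T := by
  have := (h.isCompact.image_of_continuousOn (h.continuousOn_maxOver T)).sInf_mem
    (h.nonempty.image _)
  obtain ⟨z, hz, he⟩ := this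
  exact ⟨z, hz, he⟩

lemma lt_minMax (h : IsMinMaxProblem D g ψ) (T : Finset S) {a : ℝ}
    (ha : ∀ z ∈ D, a < maxOver g ψ T z) : a < minMax D g ψ T := by
  obtain ⟨z, hz, he⟩ := h.exists_eq_minMax T
  exact he ▸ ha z hz

lemma minimizer_unique (h : IsMinMaxProblem D g ψ) (T : Finset S) {z z' : E} (hz : z ∈ D)
    (hz' : z' ∈ D) (he : maxOver g ψ T z ≤ minMax D g ψ T)
    (he' : maxOver g ψ T z' ≤ minMax D g ψ T) : z = z' :=
  (h.strictConvexOn_maxOver T).eq_of_isMinOn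
    (fun _ hy => he.trans (h.minMax_le T hy)) (fun _ hy => he'.trans (h.minMax_le T hy)) hz hz'

lemma monotone (h : IsMinMaxProblem D g ψ) : Monotone (minMax D g ψ) := by
  intro T T' hT
  obtain ⟨z, hz, he⟩ := h.exists_eq_minMax T'
  rw [← he]
  exact (h.minMax_le T hz).trans (maxOver_mono hT z)

/-- By strict convexity minimizers are unique. If adding `x` leaves the value unchanged, the
minimizer for `insert x B` is that for `B`, which therefore respects every `ψ x` with `x ∈ T`. -/
lemma locality [DecidableEq S] (h : IsMinMaxProblem D g ψ) {B T : Finset S} (hBT : B ⊆ T)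
    (hx : ∀ x ∈ T, minMax D g ψ (insert x B) = minMax D g ψ B) :
    minMax D g ψ T = minMax D g ψ B := by
  refine le_antisymm ?_ (h.monotone hBT)
  obtain ⟨z, hz, he⟩ := h.exists_eq_minMax B
  refine (h.minMax_le T hz).trans (maxOver_le_iff.2 ⟨(maxOver_le_iff.1 he.le).1, fun x hxT => ?_⟩)
  obtain ⟨z', hz', he'⟩ := h.exists_eq_minMax (insert x B)
  rw [hx x hxT] at he'
  rw [h.minimizer_unique B hz hz' he.le ((maxOver_mono (subset_insert x B) z').trans he'.le)]
  exact (maxOver_le_iff.1 he'.le).2 x (mem_insert_self x B)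

/-- Helly's theorem for strict sublevel sets: if all small subsets had a smaller value, one point
would beat the minimum for `T`. Intersecting each set with that of `g` keeps `g` from adding to the
dimension; it also makes `T = ∅` a separate case. -/
lemma exists_basis [FiniteDimensional ℝ E] (h : IsMinMaxProblem D g ψ) (T : Finset S) :
    ∃ B ⊆ T, #B ≤ Module.finrank ℝ E + 1 ∧ minMax D g ψ B = minMax D g ψ T := by
  rcases T.eq_empty_or_nonempty with rfl | hT
  · exact ⟨∅, Subset.rfl, by simp⟩
  by_contra! hcon
  have hne : (⋂ i ∈ T, {z ∈ D | ψ i z < minMax D g ψ T} ∩ {z ∈ D | g z < minMax D g ψ T}).Nonempty := by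
    refine Convex.helly_theorem' (𝕜 := ℝ) ?_ ?_
    · intro i _
      exact ((h.strictConvexOn i).convexOn.convex_lt _).inter
        (h.strictConvexOn_base.convexOn.convex_lt _)
    · intro B hB hBc
      have hlt : minMax D g ψ B < minMax D g ψ T :=
        lt_of_le_of_ne (h.monotone hB) (hcon B hB hBc)
      obtain ⟨z, hz, he⟩ := h.exists_eq_minMax B
      rw [← he, maxOver_lt_iff] at hlt
      exact ⟨z, Set.mem_iInter₂.2 fun i hi => ⟨⟨hz, hlt.2 i hi⟩, hz, hlt.1⟩⟩
  obtain ⟨z, hz⟩ := hne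
  rw [Set.mem_iInter₂] at hz
  obtain ⟨i, hi⟩ := hT
  have : maxOver g ψ T z < minMax D g ψ T :=
    maxOver_lt_iff.2 ⟨(hz i hi).2.2, fun j hj => (hz j hj).1.2⟩
  exact absurd (h.minMax_le T (hz i hi).1.1) (not_le.2 this)

lemma add_const (h : IsMinMaxProblem D g ψ) (η : S → ℝ) :
    IsMinMaxProblem D g fun i z => ψ i z + η i where
  isCompact := h.isCompact
  nonempty := h.nonempty
  continuousOn_base := h.continuousOn_base
  strictConvexOn_base := h.strictConvexOn_base
  continuousOn i := (h.continuousOn i).add continuousOn_const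
  strictConvexOn i := (h.strictConvexOn i).add_const _

/-- Lowering an essential function strictly lowers the value. -/
lemma minMax_add_const_lt [DecidableEq S] (h : IsMinMaxProblem D g ψ) {B : Finset S} {i : S}
    (hess : minMax D g ψ (B.erase i) < minMax D g ψ B) {η : S → ℝ}
    (hη : ∀ j ∈ B, j ≠ i → η j = 0) (hi : η i < 0) :
    minMax D g (fun i z => ψ i z + η i) B < minMax D g ψ B := by
  obtain ⟨z, hz, he⟩ := h.exists_eq_minMax B
  obtain ⟨y, hy, hey⟩ := h.exists_eq_minMax (B.erase i)
  rw [← hey, maxOver_lt_iff] at hess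
  have hz' := maxOver_le_iff.1 he.le
  set a := minMax D g ψ B
  have hcomb : ∀ (φ : E → ℝ), StrictConvexOn ℝ D φ → φ z ≤ a → φ y < a → ∀ s : ℝ, 0 < s → s < 1 →
      φ ((1 - s) • z + s • y) < a := by
    intro φ hφ h1 h2 s hs hs1
    have := hφ.convexOn.2 hz hy (by linarith : (0 : ℝ) ≤ 1 - s) hs.le (by ring)
    simp only [smul_eq_mul] at this
    nlinarith
  -- Moving slightly from `z` towards `y` pushes all other functions below `a`. Only `ψ i` may rise,
  -- by at most `s * (ψ i y - a)`, and a small `s` lets the negative shift absorb this.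
  obtain ⟨s, hs, hs1, hsi⟩ : ∃ s : ℝ, 0 < s ∧ s < 1 ∧ s * (ψ i y - a) + η i < 0 := by
    have hden : 0 < |ψ i y - a| + 1 + -η i := by linarith [abs_nonneg (ψ i y - a)]
    refine ⟨-η i / (|ψ i y - a| + 1 + -η i), div_pos (by linarith) hden, ?_, ?_⟩
    · rw [div_lt_one hden]; linarith [abs_nonneg (ψ i y - a)]
    · rw [div_mul_eq_mul_div, div_add' _ _ _ hden.ne', div_lt_iff₀ hden]
      nlinarith [le_abs_self (ψ i y - a), abs_nonneg (ψ i y - a)]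
  have hmem : (1 - s) • z + s • y ∈ D :=
    h.strictConvexOn_base.1 hz hy (by linarith) hs.le (by ring)
  refine ((h.add_const η).minMax_le B hmem).trans_lt (maxOver_lt_iff.2 ⟨?_, fun j hj => ?_⟩)
  · exact hcomb g h.strictConvexOn_base hz'.1 hess.1 s hs hs1
  · by_cases hji : j = i
    · subst hji
      have := (h.strictConvexOn j).convexOn.2 hz hy (by linarith : (0 : ℝ) ≤ 1 - s) hs.le (by ring)
      simp only [smul_eq_mul] at this
      have h3 := hz'.2 j hj
      show ψ j ((1 - s) • z + s • y) + η j < a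
      nlinarith
    · show ψ j ((1 - s) • z + s • y) + η j < a
      rw [hη j hj hji, add_zero]
      exact hcomb _ (h.strictConvexOn j) (hz'.2 j hj) (hess.2 j (mem_erase.2 ⟨hji, hj⟩)) s hs hs1

/-- Arbitrarily small upward shifts of the functions make the problem nondegenerate. -/
theorem exists_nondegenerate [Fintype S] [DecidableEq S] [FiniteDimensional ℝ E]
    (h : IsMinMaxProblem D g ψ) {τ : ℝ} (hτ : 0 < τ) :
    ∃ η : S → ℝ, (∀ i, 0 ≤ η i ∧ η i ≤ τ) ∧
      IsNondegenerateLPType (Module.finrank ℝ E + 1) (minMax D g fun i z => ψ i z + η i) := by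
  set v : (S → ℝ) → Finset S → ℝ := fun η => minMax D g fun i z => ψ i z + η i with hv
  have hcongr : ∀ (η η' : S → ℝ) (C : Finset S), (∀ j ∈ C, η j = η' j) → v η C = v η' C := by
    intro η η' C hC
    simp only [hv, minMax]
    congr 2
    funext z
    exact fold_congr fun j hj => by simp only [hC j hj]
  -- A bad triple has `i` essential in `B`, absent from `C`, and equal values. Lowering `η i`
  -- strictly lowers the value of `B` and leaves that of `C` fixed, so equality occurs for at most
  -- one `η i`.
  obtain ⟨η, hη, hbad⟩ := exists_small_avoiding
    (J := {p : S × Finset S × Finset S // p.1 ∈ p.2.1 ∧ p.1 ∉ p.2.2}) (fun p => p.1.1)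
    (fun p η => v η (p.1.2.1.erase p.1.1) < v η p.1.2.1 ∧ v η p.1.2.1 = v η p.1.2.2) (by
      rintro ⟨⟨i, B, C⟩, hiB, hiC⟩ η a b
      dsimp only at hiB hiC ⊢
      wlog hab : b < a generalizing a b
      · intro h1 h2
        rcases lt_trichotomy a b with hlt | heq | hgt
        · exact (this b a hlt h2 h1).symm
        · exact heq
        · exact absurd hgt hab
      rintro ⟨h1, h2⟩ ⟨h3, h4⟩
      exfalso
      have hC : v (Function.update η i a) C = v (Function.update η i b) C := by
        refine hcongr _ _ _ fun j hj => ?_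
        have : j ≠ i := fun hji => hiC (hji ▸ hj)
        simp [this]
      have hlt := (h.add_const (Function.update η i a)).minMax_add_const_lt (i := i) (B := B) h1
        (η := Pi.single i (b - a)) (by intro j _ hj; simp [hj]) (by simp [hab])
      have heq : (fun j z => ψ j z + Function.update η i a j + (Pi.single i (b - a) : S → ℝ) j) =
          fun j z => ψ j z + Function.update η i b j := by
        funext j z
        by_cases hj : j = i
        · subst hj; simp
        · simp [hj]
      simp only [heq] at hlt
      have : v (Function.update η i b) B < v (Function.update η i a) B := hlt
      linarith) hτ
  refine ⟨η, hη, (h.add_const η).monotone, fun B T hBT hx => (h.add_const η).locality hBT hx,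
    (h.add_const η).exists_basis, fun B C hB hC hBC => ?_⟩
  refine Subset.antisymm (fun i hi => ?_) fun i hi => ?_
  · by_contra hiC
    exact hbad ⟨⟨i, B, C⟩, hi, hiC⟩ ⟨hB i hi, hBC⟩
  · by_contra hiB
    exact hbad ⟨⟨i, C, B⟩, hi, hiB⟩ ⟨hC i hi, hBC.symm⟩

end IsMinMaxProblem

end MinMax

/-! ### Penalty functions -/

section Penalty

lemma convexOn_infDist {E : Type*} [NormedAddCommGroup E] [NormedSpace ℝ E] {K : Set E}
    (hK : Convex ℝ K) (hKc : IsCompact K) (hKne : K.Nonempty) :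
    ConvexOn ℝ Set.univ fun z => Metric.infDist z K := by
  refine ⟨convex_univ, fun x _ y _ a b ha hb hab => ?_⟩
  obtain ⟨k, hk, hxk⟩ := hKc.exists_infDist_eq_dist hKne x
  obtain ⟨l, hl, hyl⟩ := hKc.exists_infDist_eq_dist hKne y
  simp only [hxk, hyl, smul_eq_mul]
  refine (Metric.infDist_le_dist_of_mem (hK hk hl ha hb hab)).trans ?_
  refine (dist_add_add_le _ _ _ _).trans ?_
  rw [dist_smul₀, dist_smul₀, Real.norm_of_nonneg ha, Real.norm_of_nonneg hb]

/-- A compact convex set is the zero set of a nonnegative continuous convex function. -/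
lemma exists_convex_penalty {E : Type*} [NormedAddCommGroup E] [NormedSpace ℝ E] {K : Set E}
    (hK : Convex ℝ K) (hKc : IsCompact K) :
    ∃ φ : E → ℝ, Continuous φ ∧ ConvexOn ℝ Set.univ φ ∧ (∀ z, 0 ≤ φ z) ∧
      ∀ z, φ z = 0 ↔ z ∈ K := by
  -- `Metric.infDist` to `∅` is `0`, so the empty set needs another penalty.
  rcases K.eq_empty_or_nonempty with rfl | hne
  · exact ⟨fun _ => 1, continuous_const, convexOn_const _ convex_univ, fun _ => zero_le_one,
      by simp⟩
  · exact ⟨fun z => Metric.infDist z K, Metric.continuous_infDist_pt K,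
      convexOn_infDist hK hKc hne, fun _ => Metric.infDist_nonneg,
      fun z => (hKc.isClosed.mem_iff_infDist_zero hne).symm⟩

/-- Pointwise, either `a z > 0` and the left side drops below it, or the penalty `n * h z` grows
without bound. The sets where the inequality holds are open and increasing in `n`, so compactness
makes `n` uniform. -/
lemma eventually_lt_add_mul {E : Type*} [TopologicalSpace E] {D : Set E} (hD : IsCompact D)
    {a h : E → ℝ} (ha : Continuous a) (hh : Continuous h) (h0 : ∀ z, 0 ≤ h z)
    (hpos : ∀ z ∈ D, a z ≤ 0 → 0 < h z) {R : ℝ} (hR : 0 ≤ R) :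
    ∀ᶠ n : ℕ in Filter.atTop, ∀ z ∈ D, R / ((n : ℝ) + 1) < a z + n * h z := by
  have hmono : Monotone fun n : ℕ => {z | R / ((n : ℝ) + 1) < a z + n * h z} := by
    intro n n' hn z hz
    have hn' : (n : ℝ) ≤ n' := by exact_mod_cast hn
    calc R / ((n' : ℝ) + 1) ≤ R / ((n : ℝ) + 1) := by gcongr
      _ < a z + n * h z := hz
      _ ≤ a z + n' * h z := by gcongr; exact h0 z
  obtain ⟨n, hn⟩ := hD.elim_directed_cover
    (fun n : ℕ => {z | R / ((n : ℝ) + 1) < a z + n * h z})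
    (fun n => isOpen_lt continuous_const (by fun_prop)) (by
      intro z hz
      have hlim : Filter.Tendsto (fun n : ℕ => R / ((n : ℝ) + 1)) Filter.atTop (nhds 0) := by
        simpa [div_eq_mul_inv] using
          (tendsto_one_div_add_atTop_nhds_zero_nat (𝕜 := ℝ)).const_mul R
      rw [Set.mem_iUnion]
      rcases le_or_gt (a z) 0 with hz0 | hz0
      · have hlim' : Filter.Tendsto (fun n : ℕ => a z + n * h z) Filter.atTop Filter.atTop :=
          Filter.tendsto_atTop_add_const_left _ _
            (tendsto_natCast_atTop_atTop.atTop_mul_const (hpos z hz hz0))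
        exact ((hlim.eventually (gt_mem_nhds zero_lt_one)).and
          (hlim'.eventually_ge_atTop 1)).exists.imp fun n hn => hn.1.trans_le hn.2
      · exact (hlim.eventually (gt_mem_nhds hz0)).exists.imp fun n hn =>
          (show R / ((n : ℝ) + 1) < a z from hn).trans_le
            (le_add_of_nonneg_right (mul_nonneg n.cast_nonneg (h0 z))))
    hmono.directed_le
  filter_upwards [Filter.eventually_ge_atTop n] with n' hn' z hz
  exact hmono hn' (hn hz)

end Penalty

/-! ### From convex constraints to a nondegenerate min-max problem -/

section Counting

open Finset

open Classical in
/-- Among all `N`-subsets of `m` convex constraints, the number of those whose unique optimal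
solution violates at least `k` constraints. -/
theorem card_solution_violations_le {E : Type*} [NormedAddCommGroup E] [InnerProductSpace ℝ E]
    [FiniteDimensional ℝ E] {m : ℕ} {C : Fin m → Set E} (hC : ∀ i, Convex ℝ (C i)) (c : E)
    {F : Set (Finset (Fin m))} {θ : Finset (Fin m) → E} (hθ : ∀ T ∈ F, ∀ i ∈ T, θ T ∈ C i)
    (huniq : ∀ T ∈ F, ∀ z, (∀ i ∈ T, z ∈ C i) → inner ℝ c z ≤ inner ℝ c (θ T) → z = θ T)
    {N k : ℕ} (hN : Module.finrank ℝ E + 1 ≤ N) :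
    #{T ∈ powersetCard N (univ : Finset (Fin m)) | T ∈ F ∧ k ≤ #{x | θ T ∉ C x}} ≤
      #{T ∈ powersetCard N (univ : Finset (Fin m)) |
        #{x ∈ T | x.val < k + Module.finrank ℝ E} ≤ Module.finrank ℝ E} := by
  rcases F.eq_empty_or_nonempty with rfl | hF
  · simp
  set W : Set E := θ '' F
  have hWfin : W.Finite := F.toFinite.image θ
  have hsub : ∀ T ∈ F, θ T ∈ convexHull ℝ W := fun T hT => subset_convexHull ℝ W ⟨T, hT, rfl⟩
  -- The hull of `W ∩ C i` replaces `C i`, which need not be compact or closed. It lies in `C i` and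
  -- contains every solution that has to satisfy constraint `i`.
  have hpen := fun i => exists_convex_penalty (convex_convexHull ℝ (W ∩ C i))
    ((hWfin.inter_of_left (C i)).isCompact_convexHull (𝕜 := ℝ))
  choose φ hφc hφconv hφ0 hφK using hpen
  have hφC : ∀ i z, φ i z = 0 → z ∈ C i := fun i z hz =>
    convexHull_min Set.inter_subset_right (hC i) ((hφK i z).1 hz)
  have hφθ : ∀ T ∈ F, ∀ i ∈ T, φ i (θ T) = 0 := fun T hT i hi =>
    (hφK i _).2 (subset_convexHull ℝ _ ⟨⟨T, hT, rfl⟩, hθ T hT i hi⟩)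
  -- Positivity of the penalty comes from uniqueness: a point at least as good as `θ T` with zero
  -- penalty is `θ T` itself, which is not in `C x`. The left side pays for the regularizer `‖θ T‖ ^
  -- 2 / (n + 1)` and for a shift of at most `1 / (n + 1)`.
  have hev : ∀ᶠ n : ℕ in Filter.atTop, ∀ (T : Finset (Fin m)) (x : Fin m), T ∈ F → θ T ∉ C x →
      ∀ z ∈ convexHull ℝ W, (‖θ T‖ ^ 2 + 1) / ((n : ℝ) + 1) <
        (inner ℝ c z - inner ℝ c (θ T)) +
          n * ((∑ i ∈ insert x T, φ i z) / #(insert x T)) := by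
    simp only [Filter.eventually_all]
    intro T x hT hx
    refine eventually_lt_add_mul (hWfin.isCompact_convexHull (𝕜 := ℝ)) (by fun_prop) ?_ ?_ ?_
      (by positivity)
    · exact (continuous_finsetSum _ fun i _ => hφc i).div_const _
    · exact fun z => div_nonneg (sum_nonneg fun i _ => hφ0 i z) (Nat.cast_nonneg _)
    · intro z _ hz
      refine div_pos (lt_of_le_of_ne (sum_nonneg fun i _ => hφ0 i z) fun h => ?_)
        (by rw [Nat.cast_pos, card_pos]; exact insert_nonempty _ _)
      have h0 := (sum_eq_zero_iff_of_nonneg fun i _ => hφ0 i z).1 h.symm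
      have hzθ := huniq T hT z (fun i hi => hφC i z (h0 i (mem_insert_of_mem hi))) (by linarith)
      exact hx (hzθ ▸ hφC x z (h0 x (mem_insert_self _ _)))
  obtain ⟨n, hn⟩ := hev.exists
  have hn1 : (0 : ℝ) < (n : ℝ) + 1 := by positivity
  set g : E → ℝ := fun z => inner ℝ c z + ‖z‖ ^ 2 / ((n : ℝ) + 1) with hg
  have hgc : Continuous g := by fun_prop
  have hgconv : StrictConvexOn ℝ (convexHull ℝ W) g := by
    have h : StrongConvexOn (convexHull ℝ W) (2 / ((n : ℝ) + 1)) g := by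
      rw [strongConvexOn_iff_convex]
      have : (fun z => g z - 2 / ((n : ℝ) + 1) / 2 * ‖z‖ ^ 2) = fun z => innerSL ℝ c z := by
        funext z
        simp only [hg, innerSL_apply_apply]
        field_simp
        ring
      rw [this]
      exact (innerSL ℝ c).toLinearMap.convexOn (convex_convexHull ℝ W)
    exact h.strictConvexOn (by positivity)
  have hP : IsMinMaxProblem (convexHull ℝ W) g fun i z => g z + n * φ i z := by
    refine ⟨hWfin.isCompact_convexHull (𝕜 := ℝ), (hF.image θ).convexHull, hgc.continuousOn,
      hgconv, fun i => (hgc.add ((hφc i).const_mul _)).continuousOn, fun i => ?_⟩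
    exact hgconv.add_convexOn
      (((hφconv i).subset (Set.subset_univ _) (convex_convexHull ℝ W)).smul n.cast_nonneg)
  obtain ⟨η, hη, hw⟩ := hP.exists_nondegenerate (τ := 1 / ((n : ℝ) + 1)) (by positivity)
  have hP' := hP.add_const η
  have hviol : ∀ T ∈ F, ∀ x, θ T ∉ C x →
      minMax (convexHull ℝ W) g (fun i z => g z + n * φ i z + η i) T <
        minMax (convexHull ℝ W) g (fun i z => g z + n * φ i z + η i) (insert x T) := by
    intro T hT x hx
    have h1 : minMax (convexHull ℝ W) g (fun i z => g z + n * φ i z + η i) T ≤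
        g (θ T) + 1 / ((n : ℝ) + 1) := by
      refine (hP'.minMax_le T (hsub T hT)).trans (maxOver_le_iff.2 ⟨?_, fun i hi => ?_⟩)
      · linarith [div_pos one_pos hn1]
      · rw [hφθ T hT i hi, mul_zero, add_zero]
        linarith [(hη i).2]
    refine h1.trans_lt (hP'.lt_minMax _ fun z hz => not_le.1 fun hle => ?_)
    have h2 := (maxOver_le_iff.1 hle).2
    have hcard : (0 : ℝ) < #(insert x T) := by
      rw [Nat.cast_pos, card_pos]; exact insert_nonempty _ _
    -- A bound on the maximum of the penalties bounds their average, the continuous quantity used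
    -- above.
    have h3 : n * ((∑ i ∈ insert x T, φ i z) / #(insert x T)) ≤
        g (θ T) + 1 / ((n : ℝ) + 1) - g z := by
      rw [mul_div_assoc', div_le_iff₀ hcard, mul_sum, mul_comm _ (#(insert x T) : ℝ),
        ← nsmul_eq_mul, ← sum_const]
      exact sum_le_sum fun i hi => by linarith [h2 i hi, (hη i).1]
    have h4 := hn T x hT hx z hz
    have h5 : 0 ≤ ‖z‖ ^ 2 / ((n : ℝ) + 1) := by positivity
    rw [add_div] at h4
    simp only [hg] at h3
    linarith
  refine (card_le_card fun T hT => ?_).trans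
    ((hw.card_violators_le (N := N) (k := k) (Nat.succ_pos _) hN).trans
      (card_le_card fun T hT => ?_))
  · simp only [mem_filter] at hT ⊢
    refine ⟨hT.1, hT.2.2.trans (card_le_card fun x hx => ?_)⟩
    simp only [mem_filter, mem_univ, true_and] at hx ⊢
    exact hviol T hT.2.1 x hx
  · simp only [mem_filter] at hT ⊢
    exact ⟨hT.1, Nat.lt_succ_iff.1 hT.2⟩

end Counting

/-! ### Binomial and hypergeometric tails -/

section BinomialTail

open Finset Filter Topology

/-- By Pascal's rule, one more trial lowers the tail by `ε` times its last term. -/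
lemma binomialTail_succ_le (n N : ℕ) {ε : ℝ} (h0 : 0 ≤ ε) (h1 : ε ≤ 1) :
    binomialTail n (N + 1) ε ≤ binomialTail n N ε := by
  set b : ℕ → ℕ → ℝ := fun N i => (N.choose i : ℝ) * ε ^ i * (1 - ε) ^ (N - i) with hb
  have hsucc : ∀ i, b (N + 1) (i + 1) = ε * b N i + (1 - ε) * b N (i + 1) := by
    intro i
    have h : (N.choose (i + 1) : ℝ) * (1 - ε) ^ (N - i) =
        (N.choose (i + 1) : ℝ) * ((1 - ε) ^ (N - (i + 1)) * (1 - ε)) := by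
      rcases le_or_gt (i + 1) N with hi | hi
      · rw [← pow_succ]; congr 2; omega
      · rw [Nat.choose_eq_zero_of_lt hi]; simp
    simp only [hb, Nat.choose_succ_succ, Nat.add_sub_add_right, Nat.cast_add]
    linear_combination ε ^ (i + 1) * h
  have hzero : b (N + 1) 0 = (1 - ε) * b N 0 := by simp [hb, pow_succ']
  have hnn : 0 ≤ b N n := by
    have : 0 ≤ 1 - ε := by linarith
    positivity
  have h2 : ∑ i ∈ range (n + 1), b (N + 1) i =
      (1 - ε) * ∑ i ∈ range (n + 1), b N i + ε * ∑ i ∈ range n, b N i := by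
    rw [sum_range_succ', sum_range_succ' (fun i => b N i), hzero]
    simp only [hsucc, sum_add_distrib, ← mul_sum]
    ring
  show ∑ i ∈ range (n + 1), b (N + 1) i ≤ ∑ i ∈ range (n + 1), b N i
  rw [h2, sum_range_succ (fun i => b N i)]
  nlinarith

lemma binomialTail_antitone (n : ℕ) {ε : ℝ} (h0 : 0 ≤ ε) (h1 : ε ≤ 1) :
    Antitone fun N => binomialTail n N ε :=
  antitone_nat_of_succ_le fun N => binomialTail_succ_le n N h0 h1

lemma binomialTail_eq_one {n N : ℕ} (h : N ≤ n) (ε : ℝ) : binomialTail n N ε = 1 := by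
  have h1 : binomialTail n N ε = binomialTail N N ε := by
    refine (sum_subset (range_subset_range.2 (by omega)) fun i _ hi => ?_).symm
    rw [mem_range] at hi
    rw [Nat.choose_eq_zero_of_lt (by omega)]
    simp
  have h2 := add_pow ε (1 - ε) N
  rw [add_sub_cancel, one_pow] at h2
  refine h1.trans (Eq.trans ?_ h2.symm)
  refine sum_congr rfl fun i _ => ?_
  ring

lemma continuous_binomialTail (n N : ℕ) : Continuous (binomialTail n N) := by
  unfold binomialTail
  fun_prop

/-- Induction through `C(u, i + 1) = C(u, i) (u - i) / (i + 1)`, which also holds over the reals for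
`i > u`, where both coefficients vanish. -/
lemma tendsto_choose_div_pow {u : ℕ → ℕ} {a : ℝ}
    (hu : Tendsto (fun M : ℕ => (u M : ℝ) / M) atTop (𝓝 a)) (i : ℕ) :
    Tendsto (fun M : ℕ => ((u M).choose i : ℝ) / (M : ℝ) ^ i) atTop (𝓝 (a ^ i / i.factorial)) := by
  induction i with
  | zero => simp
  | succ i ih =>
    have h1 : Tendsto (fun M : ℕ => ((u M : ℝ) / M - i / M) / (i + 1)) atTop
        (𝓝 ((a - 0) / (i + 1))) :=
      (hu.sub (tendsto_const_div_atTop_nhds_zero_nat _)).div_const _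
    have h2 := ih.mul h1
    refine (h2.congr fun M => ?_).trans_eq ?_
    · have h3 : ((u M).choose (i + 1) : ℝ) * (i + 1) = (u M).choose i * ((u M : ℝ) - i) := by
        rcases le_or_gt i (u M) with hi | hi
        · rw [← Nat.cast_sub hi]
          exact_mod_cast Nat.choose_succ_right_eq (u M) i
        · rw [Nat.choose_eq_zero_of_lt hi, Nat.choose_eq_zero_of_lt (by omega)]
          simp
      have h4 : ((u M).choose (i + 1) : ℝ) = (u M).choose i * ((u M : ℝ) - i) / (i + 1) := by
        rw [← h3]; field_simp
      rw [h4, ← sub_div, pow_succ]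
      simp only [div_eq_mul_inv, mul_inv]
      ring
    · congr 1
      rw [Nat.factorial_succ, pow_succ]
      push_cast
      rw [sub_zero, div_mul_div_comm, mul_comm ((i : ℝ) + 1)]

/-- The hypergeometric tail converges to the binomial tail. -/
lemma tendsto_hypergeometric_tail {n N : ℕ} (hN : n < N) {ε : ℝ} (h0 : 0 ≤ ε) (h1 : ε ≤ 1) :
    Tendsto (fun M : ℕ => (∑ i ∈ range (n + 1), ((⌈ε * M⌉₊ + n).choose i *
        (N + M - (⌈ε * M⌉₊ + n)).choose (N - i) : ℝ)) / (N + M).choose N) atTop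
      (𝓝 (binomialTail n N ε)) := by
  have hK : Tendsto (fun M : ℕ => ((⌈ε * M⌉₊ + n : ℕ) : ℝ) / M) atTop (𝓝 ε) := by
    have := ((tendsto_nat_ceil_mul_div_atTop h0).comp tendsto_natCast_atTop_atTop).add
      (tendsto_const_div_atTop_nhds_zero_nat (n : ℝ))
    rw [add_zero] at this
    refine this.congr fun M => ?_
    simp only [Function.comp_apply]
    push_cast
    ring
  have hself : Tendsto (fun M : ℕ => (M : ℝ) / M) atTop (𝓝 1) := by
    refine tendsto_const_nhds.congr' ?_
    filter_upwards [eventually_gt_atTop 0] with M hM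
    rw [div_self (by positivity)]
  have hm : Tendsto (fun M : ℕ => ((N + M : ℕ) : ℝ) / M) atTop (𝓝 1) := by
    have := (tendsto_const_div_atTop_nhds_zero_nat (N : ℝ)).add hself
    rw [zero_add] at this
    refine this.congr fun M => ?_
    push_cast
    ring
  have hle : ∀ M : ℕ, ⌈ε * M⌉₊ + n ≤ N + M := by
    intro M
    have : ⌈ε * M⌉₊ ≤ M := Nat.ceil_le.2 (by nlinarith [(Nat.cast_nonneg M : (0 : ℝ) ≤ M)])
    omega
  have hR : Tendsto (fun M : ℕ => ((N + M - (⌈ε * M⌉₊ + n) : ℕ) : ℝ) / M) atTop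
      (𝓝 (1 - ε)) := by
    refine (hm.sub hK).congr fun M => ?_
    rw [Nat.cast_sub (hle M), sub_div]
  have hterm : ∀ i ∈ range (n + 1), Tendsto (fun M : ℕ => ((⌈ε * M⌉₊ + n).choose i *
        (N + M - (⌈ε * M⌉₊ + n)).choose (N - i) : ℝ) / (N + M).choose N) atTop
      (𝓝 ((N.choose i : ℝ) * ε ^ i * (1 - ε) ^ (N - i))) := by
    intro i hi
    rw [mem_range] at hi
    have h2 := ((tendsto_choose_div_pow hK i).mul (tendsto_choose_div_pow hR (N - i))).div
      (tendsto_choose_div_pow hm N) (by positivity)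
    have heq : ε ^ i / (i.factorial : ℝ) * ((1 - ε) ^ (N - i) / ((N - i).factorial : ℝ)) /
        (1 ^ N / (N.factorial : ℝ)) = (N.choose i : ℝ) * ε ^ i * (1 - ε) ^ (N - i) := by
      rw [Nat.cast_choose ℝ (show i ≤ N by omega)]
      have := Nat.factorial_ne_zero i
      have := Nat.factorial_ne_zero (N - i)
      have := Nat.factorial_ne_zero N
      field_simp
      simp
    rw [heq] at h2
    refine h2.congr' ?_
    filter_upwards [eventually_gt_atTop 0] with M hM
    have hM' : (0 : ℝ) < M := by exact_mod_cast hM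
    have hp : (M : ℝ) ^ N = (M : ℝ) ^ i * (M : ℝ) ^ (N - i) := by
      rw [← pow_add]; congr 1; omega
    simp only [Pi.div_apply]
    rw [div_mul_div_comm, ← hp, div_div_div_cancel_right₀ (by positivity)]
  have := tendsto_finsetSum _ hterm
  refine this.congr fun M => ?_
  rw [sum_div]

lemma card_powersetCard_filter_inter_le {m : ℕ} (A : Finset (Fin m)) (n N : ℕ) :
    #{T ∈ powersetCard N (univ : Finset (Fin m)) | #{x ∈ T | x ∈ A} ≤ n} ≤
      ∑ i ∈ range (n + 1), (#A).choose i * (m - #A).choose (N - i) := by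
  have hmaps : ∀ T ∈ {T ∈ powersetCard N (univ : Finset (Fin m)) | #{x ∈ T | x ∈ A} ≤ n},
      #{x ∈ T | x ∈ A} ∈ range (n + 1) := fun T hT => by
    rw [mem_range]
    exact Nat.lt_succ_of_le (mem_filter.1 hT).2
  rw [card_eq_sum_card_fiberwise hmaps]
  refine sum_le_sum fun i _ => ?_
  have hAc : m - #A = #Aᶜ := by rw [card_compl, Fintype.card_fin]
  rw [hAc, ← card_powersetCard, ← card_powersetCard, ← card_product]
  refine card_le_card_of_injOn (fun T => ({x ∈ T | x ∈ A}, {x ∈ T | x ∉ A})) ?_ ?_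
  · intro T hT
    simp only [coe_filter, mem_filter, mem_powersetCard, subset_univ, true_and,
      Set.mem_ofPred_eq] at hT
    simp only [coe_product, Set.mem_prod, mem_coe, mem_powersetCard]
    have := card_filter_add_card_filter_not (s := T) (fun x => x ∈ A)
    refine ⟨⟨fun x hx => (mem_filter.1 hx).2, hT.2⟩, fun x hx => ?_, by omega⟩
    rw [mem_compl]
    exact (mem_filter.1 hx).2
  · intro T _ T' _ h
    simp only [Prod.mk.injEq] at h
    rw [← filter_union_filter_not_eq (fun x => x ∈ A) T, h.1, h.2,
      filter_union_filter_not_eq]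

end BinomialTail

/-! ### Laws of independent samples, and Chebyshev's inequality -/

section Sampling

variable {Ω Q : Type*} [MeasurableSpace Ω] [MeasurableSpace Q]

/-- Serves both to split `N + M` samples along an `N`-subset and to separate the design and
validation samples of one iteration. -/
lemma map_eq_prod_pi {ι ι₁ ι₂ : Type*} [Fintype ι₁] [Fintype ι₂] {P : Measure Ω}
    [IsProbabilityMeasure P] {μ : Measure Q} [IsProbabilityMeasure μ] {X : ι → Ω → Q}
    (hX : ∀ s, Measurable (X s)) (hlaw : ∀ s, P.map (X s) = μ) (hindep : iIndepFun X P)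
    {e : ι₁ ⊕ ι₂ → ι} (he : Function.Injective e) :
    P.map (fun ω => (fun i => X (e (.inl i)) ω, fun j => X (e (.inr j)) ω)) =
      (Measure.pi fun _ : ι₁ => μ).prod (Measure.pi fun _ : ι₂ => μ) := by
  have h1 := (iIndepFun_iff_map_fun_eq_pi_map fun s => (hX (e s)).aemeasurable).1
    (hindep.precomp he)
  simp only [hlaw] at h1
  have h2 := (measurePreserving_sumPiEquivProdPi (fun _ : ι₁ ⊕ ι₂ => μ)).map_eq
  rw [← h1, Measure.map_map (MeasurableEquiv.measurable _)
    (measurable_pi_lambda _ fun s => hX (e s))] at h2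
  exact h2

lemma map_eq_pi {ι ι₁ : Type*} [Fintype ι₁] {P : Measure Ω}
    [IsProbabilityMeasure P] {μ : Measure Q} {X : ι → Ω → Q}
    (hX : ∀ s, Measurable (X s)) (hlaw : ∀ s, P.map (X s) = μ) (hindep : iIndepFun X P)
    {e : ι₁ → ι} (he : Function.Injective e) :
    P.map (fun ω i => X (e i) ω) = Measure.pi fun _ : ι₁ => μ := by
  have h1 := (iIndepFun_iff_map_fun_eq_pi_map fun s => (hX (e s)).aemeasurable).1
    (hindep.precomp he)
  simpa only [hlaw] using h1

lemma prod_real_le_of_forall {α β : Type*} [MeasurableSpace α] [MeasurableSpace β]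
    {μ : Measure α} {ν : Measure β} [IsProbabilityMeasure μ] [IsProbabilityMeasure ν]
    {s : Set (α × β)} (hs : MeasurableSet s) {a : ℝ} (ha : 0 ≤ a)
    (h : ∀ x, ν.real (Prod.mk x ⁻¹' s) ≤ a) : (μ.prod ν).real s ≤ a := by
  refine ENNReal.toReal_le_of_le_ofReal ha ?_
  rw [Measure.prod_apply hs]
  calc ∫⁻ x, ν (Prod.mk x ⁻¹' s) ∂μ ≤ ∫⁻ _, ENNReal.ofReal a ∂μ := by
        refine lintegral_mono fun x => ?_
        rw [← ofReal_measureReal]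
        exact ENNReal.ofReal_le_ofReal (h x)
    _ = ENNReal.ofReal a := by simp

open Classical in
/-- Chebyshev's inequality for the number of samples that fall into a set. -/
lemma pi_real_card_lt_le {μ : Measure Q} [IsProbabilityMeasure μ] {A : Set Q}
    (hA : MeasurableSet A) {ε ε' : ℝ} (hε : ε' < ε) (hμ : ε < μ.real A) {M : ℕ} (hM : 0 < M) :
    (Measure.pi fun _ : Fin M => μ).real
      {g | Finset.card {j | g j ∈ A} < ⌈ε' * M⌉₊} ≤ 1 / ((ε - ε') ^ 2 * M) := by
  have hM' : (0 : ℝ) < M := by exact_mod_cast hM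
  set ν := Measure.pi fun _ : Fin M => μ
  set Y : Q → ℝ := A.indicator 1 with hY
  have hYm : Measurable Y := measurable_one.indicator hA
  have hYb : ∀ x, Y x ∈ Set.Icc (0 : ℝ) 1 := fun x => by
    by_cases hx : x ∈ A <;> simp [hY, hx]
  have hYL : MemLp Y 2 μ :=
    MemLp.of_bound hYm.aestronglyMeasurable 1 (Filter.Eventually.of_forall fun x => by
      rw [Real.norm_of_nonneg (hYb x).1]; exact (hYb x).2)
  have hsumL : MemLp (∑ j : Fin M, fun g : Fin M → Q => Y (g j)) 2 ν :=
    memLp_finsetSum' _ fun j _ => hYL.comp_measurePreserving (measurePreserving_eval _ j)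
  have hvar : Var[∑ j : Fin M, fun g : Fin M → Q => Y (g j); ν] ≤ M := by
    have h := variance_sum_pi (μ := fun _ : Fin M => μ) (X := fun _ => Y) fun _ => hYL
    rw [h]
    have h1 : Var[Y; μ] ≤ 1 := by
      refine (variance_le_sq_of_bounded (Filter.Eventually.of_forall hYb)
        hYm.aemeasurable).trans (by norm_num)
    simpa using mul_le_mul_of_nonneg_left h1 hM'.le
  have hmean : ν[∑ j : Fin M, fun g : Fin M → Q => Y (g j)] = M * μ.real A := by
    simp only [Finset.sum_apply]
    rw [integral_finsetSum]
    · have : ∀ j : Fin M, ∫ g, Y (g j) ∂ν = μ.real A := fun j => by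
        rw [integral_comp_eval (μ := fun _ : Fin M => μ) (i := j) hYm.aestronglyMeasurable]
        exact integral_indicator_one hA
      simp [this]
    · intro j _
      exact (hYL.comp_measurePreserving (measurePreserving_eval _ j)).integrable one_le_two
  have hch := meas_ge_le_variance_div_sq hsumL (c := (ε - ε') * M)
    (mul_pos (sub_pos.2 hε) hM')
  rw [hmean] at hch
  refine (ENNReal.toReal_le_of_le_ofReal (div_nonneg (variance_nonneg _ _) (sq_nonneg _))
    (le_trans ?_ hch)).trans ?_
  · refine measure_mono fun g hg => ?_
    simp only [Set.mem_ofPred_eq] at hg ⊢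
    have hg' := Nat.lt_ceil.1 hg
    have hsum : (∑ j : Fin M, fun g : Fin M → Q => Y (g j)) g =
        (Finset.card {j | g j ∈ A} : ℝ) := by
      simp [hY, Set.indicator_apply, Finset.sum_apply]
    rw [hsum, abs_sub_comm]
    refine le_trans ?_ (le_abs_self _)
    nlinarith
  · rw [div_le_div_iff₀ (by have := sub_pos.2 hε; positivity) (by have := sub_pos.2 hε; positivity)]
    have : 0 ≤ (ε - ε') ^ 2 * M := by positivity
    calc _ ≤ (M : ℝ) * ((ε - ε') ^ 2 * M) := by gcongr
      _ = _ := by ring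

end Sampling

/-! ### Scenario solutions and measurability -/

section ScenarioSolution

variable {n : ℕ} {Q : Type*} {Θ : Set (Vec n)} {f : Vec n → Q → ℝ} {c : Vec n}

lemma isScenarioSolution_scenarioSolution (huniq : UniquenessAssumption c Θ f) {N : ℕ}
    (hN : 1 ≤ N) {q : Fin N → Q} (hq : (feasibleSet Θ f q).Nonempty) :
    IsScenarioSolution c Θ f q (scenarioSolution c Θ f q) := by
  have h := (huniq N hN q hq).exists
  rw [scenarioSolution, dif_pos h]
  exact h.choose_spec

/-- Turns feasibility into a condition on the measurable solution map. The default value `0` does no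
harm: it meets the condition only if it is feasible. -/
lemma feasibleSet_nonempty_iff (huniq : UniquenessAssumption c Θ f) {N : ℕ}
    (hN : 1 ≤ N) {q : Fin N → Q} :
    (feasibleSet Θ f q).Nonempty ↔ scenarioSolution c Θ f q ∈ feasibleSet Θ f q :=
  ⟨fun h => (isScenarioSolution_scenarioSolution huniq hN h).1, fun h => ⟨_, h⟩⟩

end ScenarioSolution

section Measurability

variable {n : ℕ} {Q : Type*} [MeasurableSpace Q] {Θ : Set (Vec n)} {f : Vec n → Q → ℝ}

/-- Measurability of `f` is available only on `Θ × Q`, so events pass through the subtype embedding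
and carry the condition `θ x ∈ Θ`. -/
lemma measurableSet_mem_and_of_prod {X : Type*} [MeasurableSpace X] (hΘ : MeasurableSet Θ)
    {R : Vec n → Q → Prop} (hR : MeasurableSet {p : Θ × Q | R p.1 p.2}) {θ : X → Vec n}
    (hθ : Measurable θ) {r : X → Q} (hr : Measurable r) :
    MeasurableSet {x | θ x ∈ Θ ∧ R (θ x) (r x)} := by
  have h := ((MeasurableEmbedding.subtype_coe hΘ).prodMap
    (MeasurableEmbedding.id (α := Q))).measurableSet_image.2 hR
  convert! (hθ.prodMk hr) h
  ext x
  constructor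
  · rintro ⟨h1, h2⟩
    exact ⟨(⟨θ x, h1⟩, r x), h2, rfl⟩
  · rintro ⟨⟨⟨y, hy⟩, z⟩, h1, h2⟩
    simp only [Prod.map_apply, id_eq, Prod.mk.injEq] at h2
    obtain ⟨h2, h3⟩ := h2
    subst h2 h3
    exact ⟨hy, h1⟩

lemma measurableSet_violation (hf : Measurable fun p : Θ × Q => f p.1 p.2) {θ : Vec n}
    (hθ : θ ∈ Θ) : MeasurableSet {q | 0 < f θ q} :=
  measurableSet_lt measurable_const (hf.comp (measurable_const.prodMk measurable_id :
    Measurable fun q : Q => ((⟨θ, hθ⟩ : Θ), q)))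

lemma measurableSet_mem_and_violationProb {X : Type*} [MeasurableSpace X] (hΘ : MeasurableSet Θ)
    (μ : Measure Q) [IsProbabilityMeasure μ] (hf : Measurable fun p : Θ × Q => f p.1 p.2)
    {s : Set ℝ} (hs : MeasurableSet s) {θ : X → Vec n} (hθ : Measurable θ) :
    MeasurableSet {x | θ x ∈ Θ ∧ violationProb μ f (θ x) ∈ s} := by
  have hV : Measurable fun y : Θ => violationProb μ f y :=
    (measurable_measure_prodMk_left (ν := μ)
      (measurableSet_lt (measurable_const (a := (0 : ℝ))) hf)).ennreal_toReal
  have h := (MeasurableEmbedding.subtype_coe hΘ).measurableSet_image.2 (hV hs)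
  convert! hθ h
  ext x
  constructor
  · rintro ⟨h1, h2⟩
    exact ⟨⟨θ x, h1⟩, h2, rfl⟩
  · rintro ⟨⟨y, hy⟩, h1, h2⟩
    rw [Set.mem_ofPred_eq, ← h2]
    exact ⟨hy, h1⟩

variable {c : Vec n}

lemma measurableSet_feasible (huniq : UniquenessAssumption c Θ f) (hΘ : MeasurableSet Θ)
    (hf : Measurable fun p : Θ × Q => f p.1 p.2) {N : ℕ} (hN : 1 ≤ N)
    (hsol : Measurable fun q : Fin N → Q => scenarioSolution c Θ f q) :
    MeasurableSet {q : Fin N → Q | (feasibleSet Θ f q).Nonempty} := by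
  have h : {q : Fin N → Q | (feasibleSet Θ f q).Nonempty} =
      ⋂ i, {q | scenarioSolution c Θ f q ∈ Θ ∧ f (scenarioSolution c Θ f q) (q i) ≤ 0} := by
    ext q
    rw [Set.mem_iInter]
    refine (feasibleSet_nonempty_iff huniq hN).trans ⟨fun h i => ⟨h.1, h.2 i⟩, fun h => ?_⟩
    exact ⟨(h ⟨0, hN⟩).1, fun i => (h i).2⟩
  rw [h]
  exact MeasurableSet.iInter fun i => measurableSet_mem_and_of_prod hΘ
    (R := fun θ q => f θ q ≤ 0) (measurableSet_le hf measurable_const) hsol (measurable_pi_apply i)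

lemma measurableSet_feasible_violationProb (huniq : UniquenessAssumption c Θ f)
    (hΘ : MeasurableSet Θ) (μ : Measure Q) [IsProbabilityMeasure μ]
    (hf : Measurable fun p : Θ × Q => f p.1 p.2) {N : ℕ} (hN : 1 ≤ N)
    (hsol : Measurable fun q : Fin N → Q => scenarioSolution c Θ f q) {s : Set ℝ}
    (hs : MeasurableSet s) :
    MeasurableSet {q : Fin N → Q | (feasibleSet Θ f q).Nonempty ∧
      violationProb μ f (scenarioSolution c Θ f q) ∈ s} := by
  convert! (measurableSet_feasible huniq hΘ hf hN hsol).inter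
    (measurableSet_mem_and_violationProb hΘ μ hf hs hsol) using 1
  ext q
  simp only [Set.mem_inter_iff, Set.mem_ofPred_eq]
  refine and_congr_right fun hq => (and_iff_right ?_).symm
  exact ((feasibleSet_nonempty_iff huniq hN).1 hq).1

end Measurability

/-! ### The binomial bound for one scenario problem -/

section ScenarioBound

open Finset

variable {n : ℕ} {Q : Type*} {c : Vec n} {Θ : Set (Vec n)} {f : Vec n → Q → ℝ}

open Classical in
lemma card_feasible_violations_le (hconv : ConvexityAssumption Θ f)
    (huniq : UniquenessAssumption c Θ f) {m N : ℕ} (hN : n + 1 ≤ N) (q : Fin m → Q)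
    {e : Finset (Fin m) → Fin N → Fin m} (he : ∀ T, #T = N → ∀ x, x ∈ T ↔ ∃ i, e T i = x)
    {k : ℕ} (hk : k + n ≤ m) :
    #{T ∈ powersetCard N (univ : Finset (Fin m)) |
        (feasibleSet Θ f fun i => q (e T i)).Nonempty ∧
          k ≤ #{x | 0 < f (scenarioSolution c Θ f fun i => q (e T i)) (q x)}} ≤
      ∑ i ∈ range (n + 1), (k + n).choose i * (m - (k + n)).choose (N - i) := by
  have hfin : Module.finrank ℝ (Vec n) = n := finrank_euclideanSpace_fin
  have hspec : ∀ T, (feasibleSet Θ f fun i => q (e T i)).Nonempty →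
      IsScenarioSolution c Θ f (fun i => q (e T i))
        (scenarioSolution c Θ f fun i => q (e T i)) := fun T hT =>
    isScenarioSolution_scenarioSolution huniq (by omega) hT
  have hmain := card_solution_violations_le (N := N) (k := k)
    -- `Θ` is folded into each constraint; as `N ≥ 1`, satisfying the constraints of `T` still
    -- forces membership in `Θ`.
    (C := fun x => {θ | θ ∈ Θ ∧ f θ (q x) ≤ 0}) (fun x => (hconv.2.2 (q x)).convex_le 0) c
    (F := {T | #T = N ∧ (feasibleSet Θ f fun i => q (e T i)).Nonempty})
    (θ := fun T => scenarioSolution c Θ f fun i => q (e T i))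
    (by
      rintro T ⟨hTN, hT⟩ x hx
      obtain ⟨i, rfl⟩ := (he T hTN x).1 hx
      exact ⟨(hspec T hT).1.1, (hspec T hT).1.2 i⟩)
    (by
      rintro T ⟨hTN, hT⟩ z hz hle
      have hmem : ∀ i, e T i ∈ T := fun i => (he T hTN _).2 ⟨i, rfl⟩
      refine (huniq N (by omega) _ hT).unique ⟨⟨(hz _ (hmem ⟨0, by omega⟩)).1,
        fun i => (hz _ (hmem i)).2⟩, fun θ' hθ' => hle.trans ((hspec T hT).2 θ' hθ')⟩ (hspec T hT))
    (by rw [hfin]; exact hN)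
  rw [hfin] at hmain
  have hA : #({x | x.val < k + n} : Finset (Fin m)) = k + n := by
    rw [Fin.card_filter_val_lt, min_eq_right hk]
  calc _ ≤ _ := card_le_card fun T hT => ?_
    _ ≤ _ := hmain
    _ ≤ _ := by
      have := card_powersetCard_filter_inter_le ({x | x.val < k + n} : Finset (Fin m)) n N
      simpa only [hA, mem_filter, mem_univ, true_and] using this
  simp only [mem_filter, mem_powersetCard, subset_univ, true_and, Set.mem_ofPred_eq] at hT ⊢
  refine ⟨hT.1, ⟨hT.1, hT.2.1⟩, hT.2.2.trans (card_le_card fun x hx => ?_)⟩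
  simp only [mem_filter, mem_univ, true_and] at hx ⊢
  exact fun h => absurd h.2 (not_le.2 hx)

/-- If `T` does not have `N` elements, any bijection will do; injectivity for all `T` keeps the laws
below free of side conditions. -/
lemma exists_sum_enumeration (N M : ℕ) (T : Finset (Fin (N + M))) :
    ∃ e : Fin N ⊕ Fin M → Fin (N + M), Function.Injective e ∧
      (#T = N → ∀ x, x ∈ T ↔ ∃ i, e (.inl i) = x) := by
  by_cases hT : #T = N
  · have hTc : #Tᶜ = M := by rw [card_compl, hT, Fintype.card_fin]; omega
    refine ⟨finSumEquivOfFinset hT hTc, (finSumEquivOfFinset hT hTc).injective, fun _ x => ?_⟩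
    simp only [finSumEquivOfFinset_inl]
    rw [← mem_coe, ← range_orderEmbOfFin T hT]
    rfl
  · exact ⟨finSumFinEquiv, finSumFinEquiv.injective, fun h => absurd h hT⟩

variable [MeasurableSpace Q]

open Classical in
lemma measurableSet_le_card {X ι : Type*} [MeasurableSpace X] [Fintype ι] {p : ι → X → Prop}
    (hp : ∀ i, MeasurableSet {x | p i x}) (k : ℕ) : MeasurableSet {x | k ≤ #{i | p i x}} := by
  have h : ∀ x, #{i | p i x} = ∑ i, Set.indicator {x | p i x} (1 : X → ℕ) x := fun x => by
    rw [card_filter]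
    exact sum_congr rfl fun i _ => by simp [Set.indicator_apply]
  simp only [h]
  exact measurableSet_le measurable_const
    (Finset.measurable_fun_sum _ fun i _ => measurable_one.indicator (hp i))

open Classical in
-- Every way of splitting `N + M` i.i.d. samples has the same law, so the probability is the
-- expected fraction of splits in the event. This fraction is bounded for each fixed sample by the
-- count above.
lemma prod_real_many_violations_le (hconv : ConvexityAssumption Θ f)
    (huniq : UniquenessAssumption c Θ f) (μ : Measure Q) [IsProbabilityMeasure μ]
    (hf : Measurable fun p : Θ × Q => f p.1 p.2) {N : ℕ} (hN : n + 1 ≤ N)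
    (hsol : Measurable fun q : Fin N → Q => scenarioSolution c Θ f q) {M k : ℕ}
    (hk : k + n ≤ N + M) :
    ((Measure.pi fun _ : Fin N => μ).prod (Measure.pi fun _ : Fin M => μ)).real
      {p | (feasibleSet Θ f p.1).Nonempty ∧ k ≤ #{j | 0 < f (scenarioSolution c Θ f p.1) (p.2 j)}} ≤
    (∑ i ∈ range (n + 1), ((k + n).choose i * (N + M - (k + n)).choose (N - i) : ℝ)) /
      (N + M).choose N := by
  set E : Set ((Fin N → Q) × (Fin M → Q)) := {p | (feasibleSet Θ f p.1).Nonempty ∧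
    k ≤ #{j | 0 < f (scenarioSolution c Θ f p.1) (p.2 j)}} with hE
  have hΘ := hconv.2.1.measurableSet
  have hEm : MeasurableSet E := by
    have h1 := (measurable_fst : Measurable (Prod.fst : (Fin N → Q) × (Fin M → Q) → _))
      (measurableSet_feasible huniq hΘ hf (by omega) hsol)
    have h2 := measurableSet_le_card (X := (Fin N → Q) × (Fin M → Q))
      (p := fun (j : Fin M) p => scenarioSolution c Θ f p.1 ∈ Θ ∧
        0 < f (scenarioSolution c Θ f p.1) (p.2 j))
      (fun j => measurableSet_mem_and_of_prod hΘ (R := fun θ q => 0 < f θ q)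
        (measurableSet_lt measurable_const hf) (hsol.comp measurable_fst)
        ((measurable_pi_apply j).comp measurable_snd)) k
    convert! h1.inter h2 using 1
    ext p
    simp only [hE, Set.mem_inter_iff, Set.mem_preimage, Set.mem_ofPred_eq]
    refine and_congr_right fun hp => ?_
    simp only [((feasibleSet_nonempty_iff huniq (by omega)).1 hp).1, true_and]
  set ν := Measure.pi fun _ : Fin (N + M) => μ with hν
  choose e he heT using exists_sum_enumeration N M
  set Φ : Finset (Fin (N + M)) → (Fin (N + M) → Q) → (Fin N → Q) × (Fin M → Q) := fun T q =>
    (fun i => q (e T (.inl i)), fun j => q (e T (.inr j))) with hΦ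
  have hΦm : ∀ T, Measurable (Φ T) := fun T => by fun_prop
  have hmap : ∀ T, ν.map (Φ T) =
      (Measure.pi fun _ : Fin N => μ).prod (Measure.pi fun _ : Fin M => μ) := fun T =>
    map_eq_prod_pi (X := fun (s : Fin (N + M)) (q : Fin (N + M) → Q) => q s)
      (fun s => measurable_pi_apply s) (fun s => (measurePreserving_eval _ s).map_eq)
      (iIndepFun_pi (μ := fun _ : Fin (N + M) => μ) (X := fun _ => id)
        fun _ => aemeasurable_id) (he T)
  have hreal : ∀ T, ν.real (Φ T ⁻¹' E) =
      ((Measure.pi fun _ : Fin N => μ).prod (Measure.pi fun _ : Fin M => μ)).real E := fun T => by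
    rw [← hmap T, map_measureReal_apply (hΦm T) hEm]
  have hpt : ∀ q : Fin (N + M) → Q,
      ∑ T ∈ powersetCard N (univ : Finset (Fin (N + M))), (Φ T ⁻¹' E).indicator (1 : (Fin (N + M) → Q) → ℝ) q ≤
        ∑ i ∈ range (n + 1), ((k + n).choose i * (N + M - (k + n)).choose (N - i) : ℝ) := by
    intro q
    have h := card_feasible_violations_le hconv huniq hN q
      (e := fun T i => e T (.inl i)) heT hk
    have h1 : ∑ T ∈ powersetCard N (univ : Finset (Fin (N + M))),
        (Φ T ⁻¹' E).indicator (1 : (Fin (N + M) → Q) → ℝ) q =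
          (#{T ∈ powersetCard N (univ : Finset (Fin (N + M))) | q ∈ Φ T ⁻¹' E} : ℝ) := by
      rw [card_filter]
      push_cast
      exact sum_congr rfl fun T _ => by simp [Set.indicator_apply]
    rw [h1]
    refine le_trans (Nat.cast_le.2 ((card_le_card fun T hT => ?_).trans h)) (by push_cast; rfl)
    simp only [mem_filter, Set.mem_preimage, hE, Set.mem_ofPred_eq, hΦ] at hT ⊢
    refine ⟨hT.1, hT.2.1, hT.2.2.trans ?_⟩
    refine card_le_card_of_injOn (fun j => e T (.inr j)) (fun j hj => ?_)
      fun j _ j' _ hjj => Sum.inr_injective (he T hjj)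
    simpa using hj
  have hint : ∀ T, Integrable ((Φ T ⁻¹' E).indicator (1 : (Fin (N + M) → Q) → ℝ)) ν := fun T =>
    (integrable_const (1 : ℝ)).indicator (hΦm T hEm)
  have hsum := integral_mono (μ := ν) (integrable_finsetSum _ fun T _ => hint T)
    (integrable_const _) hpt
  rw [integral_finsetSum _ fun T _ => hint T] at hsum
  simp only [integral_indicator_one (hΦm _ hEm), hreal, sum_const, card_powersetCard, card_univ,
    Fintype.card_fin, nsmul_eq_mul, integral_const, probReal_univ, one_smul] at hsum
  rw [le_div_iff₀ (by exact_mod_cast Nat.choose_pos (by omega)), mul_comm]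
  exact hsum

/-- The binomial bound on the violation probability of the solution of a scenario problem. -/
theorem pi_real_violation_le_binomialTail (hconv : ConvexityAssumption Θ f)
    (huniq : UniquenessAssumption c Θ f) (μ : Measure Q) [IsProbabilityMeasure μ]
    (hf : Measurable fun p : Θ × Q => f p.1 p.2) {N : ℕ} (hN : 1 ≤ N)
    (hsol : Measurable fun q : Fin N → Q => scenarioSolution c Θ f q) {ε : ℝ} (h0 : 0 < ε)
    (h1 : ε < 1) :
    (Measure.pi fun _ : Fin N => μ).real {q | (feasibleSet Θ f q).Nonempty ∧
      violationProb μ f (scenarioSolution c Θ f q) ∈ Set.Ioi ε} ≤ binomialTail n N ε := by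
  classical
  rcases le_or_gt N n with hNn | hNn
  · rw [binomialTail_eq_one hNn]
    exact measureReal_le_one
  have hΘ := hconv.2.1.measurableSet
  set G : Set (Fin N → Q) := {q | (feasibleSet Θ f q).Nonempty ∧
    violationProb μ f (scenarioSolution c Θ f q) ∈ Set.Ioi ε} with hG
  have hGm : MeasurableSet G :=
    measurableSet_feasible_violationProb huniq hΘ μ hf hN hsol measurableSet_Ioi
  -- The gap `ε - ε'` gives Chebyshev room: a solution with `V > ε` has at least `ε' M` violations
  -- among `M` fresh samples, up to an error vanishing with `M`. Continuity of the tail in `ε'`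
  -- closes the gap afterwards.
  have hlower : ∀ ε' : ℝ, 0 < ε' → ε' < ε →
      (Measure.pi fun _ : Fin N => μ).real G ≤ binomialTail n N ε' := by
    intro ε' h0' hlt
    have hbound : ∀ᶠ M : ℕ in Filter.atTop, (Measure.pi fun _ : Fin N => μ).real G ≤
        (∑ i ∈ range (n + 1), ((⌈ε' * M⌉₊ + n).choose i *
          (N + M - (⌈ε' * M⌉₊ + n)).choose (N - i) : ℝ)) / (N + M).choose N +
          1 / ((ε - ε') ^ 2 * M) := by
      filter_upwards [Filter.eventually_gt_atTop 0] with M hM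
      have hceil : ⌈ε' * M⌉₊ ≤ M :=
        Nat.ceil_le.2 (by nlinarith [(Nat.cast_nonneg M : (0 : ℝ) ≤ M)])
      set π₁ := Measure.pi fun _ : Fin N => μ
      set π₂ := Measure.pi fun _ : Fin M => μ
      have hmany := prod_real_many_violations_le hconv huniq μ hf hNn hsol
        (M := M) (k := ⌈ε' * M⌉₊) (by omega)
      set E : Set ((Fin N → Q) × (Fin M → Q)) := {p | (feasibleSet Θ f p.1).Nonempty ∧
        ⌈ε' * M⌉₊ ≤ #{j | 0 < f (scenarioSolution c Θ f p.1) (p.2 j)}}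
      set B : Set ((Fin N → Q) × (Fin M → Q)) := {p | p.1 ∈ G ∧
        #{j | 0 < f (scenarioSolution c Θ f p.1) (p.2 j)} < ⌈ε' * M⌉₊}
      have hBm : MeasurableSet B := by
        have h2 := measurableSet_le_card (X := (Fin N → Q) × (Fin M → Q))
          (p := fun (j : Fin M) p => scenarioSolution c Θ f p.1 ∈ Θ ∧
            0 < f (scenarioSolution c Θ f p.1) (p.2 j))
          (fun j => measurableSet_mem_and_of_prod hΘ (R := fun θ q => 0 < f θ q)
            (measurableSet_lt measurable_const hf) (hsol.comp measurable_fst)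
            ((measurable_pi_apply j).comp measurable_snd)) ⌈ε' * M⌉₊
        convert! ((measurable_fst : Measurable (Prod.fst : (Fin N → Q) × (Fin M → Q) → _)) hGm).inter h2.compl using 1
        ext p
        simp only [Set.mem_inter_iff, Set.mem_preimage, Set.mem_ofPred_eq, Set.mem_compl_iff,
          not_le, B]
        refine and_congr_right fun hp => ?_
        simp only [((feasibleSet_nonempty_iff huniq hN).1 hp.1).1, true_and]
      have hBle : (π₁.prod π₂).real B ≤ 1 / ((ε - ε') ^ 2 * M) := by
        refine prod_real_le_of_forall hBm (by positivity) fun q => ?_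
        by_cases hq : q ∈ G
        · have hA := measurableSet_violation hf ((feasibleSet_nonempty_iff huniq hN).1 hq.1).1
          refine le_trans (measureReal_mono fun g hg => ?_) (pi_real_card_lt_le hA hlt hq.2 hM)
          exact hg.2
        · have : Prod.mk q ⁻¹' B = ∅ := by
            ext g
            simp [B, hq]
          rw [this, measureReal_empty]
          positivity
      have hGprod : π₁.real G = (π₁.prod π₂).real (G ×ˢ Set.univ) := by
        rw [measureReal_prod_prod, probReal_univ, mul_one]
      rw [hGprod]
      calc (π₁.prod π₂).real (G ×ˢ Set.univ) ≤ (π₁.prod π₂).real (E ∪ B) := by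
            refine measureReal_mono fun p hp => ?_
            rcases le_or_gt ⌈ε' * M⌉₊ #{j | 0 < f (scenarioSolution c Θ f p.1) (p.2 j)} with h | h
            · exact Or.inl ⟨hp.1.1, h⟩
            · exact Or.inr ⟨hp.1, h⟩
        _ ≤ (π₁.prod π₂).real E + (π₁.prod π₂).real B := measureReal_union_le _ _
        _ ≤ _ := by
            refine add_le_add ?_ hBle
            exact hmany
    have hlim := (tendsto_hypergeometric_tail hNn h0'.le (hlt.trans h1).le).add
      ((tendsto_const_div_atTop_nhds_zero_nat (1 / (ε - ε') ^ 2)).congr fun M => by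
        rw [div_div])
    rw [add_zero] at hlim
    exact ge_of_tendsto hlim hbound
  have hcont : Filter.Tendsto (binomialTail n N) (nhdsWithin ε (Set.Iio ε))
      (nhds (binomialTail n N ε)) := (continuous_binomialTail n N).continuousWithinAt
  refine ge_of_tendsto hcont ?_
  filter_upwards [Ioo_mem_nhdsLT h0] with ε' hε'
  exact hlower ε' hε'.1 hε'.2

end ScenarioBound

/-! ### Validation and its error budget -/

section Validation

lemma violationIndicator_eq_zero_iff {n : ℕ} {Q : Type*} {f : Vec n → Q → ℝ} {θ : Vec n} {q : Q} :
    violationIndicator f θ q = 0 ↔ f θ q ≤ 0 := by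
  simp [violationIndicator]

variable {n : ℕ} {Q : Type*} [MeasurableSpace Q] {c : Vec n} {Θ : Set (Vec n)}
  {f : Vec n → Q → ℝ}

lemma measurableSet_feasible_validated (huniq : UniquenessAssumption c Θ f)
    (hΘ : MeasurableSet Θ) (hf : Measurable fun p : Θ × Q => f p.1 p.2) {N : ℕ} (hN : 1 ≤ N)
    (hsol : Measurable fun q : Fin N → Q => scenarioSolution c Θ f q) (M : ℕ) :
    MeasurableSet {p : (Fin N → Q) × (Fin M → Q) | (feasibleSet Θ f p.1).Nonempty ∧
      ∀ i, violationIndicator f (scenarioSolution c Θ f p.1) (p.2 i) = 0} := by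
  have h1 := (measurable_fst : Measurable (Prod.fst : (Fin N → Q) × (Fin M → Q) → _))
    (measurableSet_feasible huniq hΘ hf hN hsol)
  have h2 : MeasurableSet (⋂ j : Fin M, {p : (Fin N → Q) × (Fin M → Q) |
      scenarioSolution c Θ f p.1 ∈ Θ ∧ f (scenarioSolution c Θ f p.1) (p.2 j) ≤ 0}) :=
    MeasurableSet.iInter fun j => measurableSet_mem_and_of_prod hΘ (R := fun θ q => f θ q ≤ 0)
      (measurableSet_le hf measurable_const) (hsol.comp measurable_fst)
      ((measurable_pi_apply j).comp measurable_snd)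
  convert! h1.inter h2 using 1
  ext p
  simp only [Set.mem_inter_iff, Set.mem_preimage, Set.mem_ofPred_eq, Set.mem_iInter,
    violationIndicator_eq_zero_iff]
  refine and_congr_right fun hp => ?_
  simp only [((feasibleSet_nonempty_iff huniq hN).1 hp).1, true_and]

/-- A solution with violation probability above `ε` passes the validation with `M` fresh samples
with probability at most `(1 - ε) ^ M`. -/
lemma prod_real_validated_le (huniq : UniquenessAssumption c Θ f)
    (hΘ : MeasurableSet Θ) (μ : Measure Q) [IsProbabilityMeasure μ]
    (hf : Measurable fun p : Θ × Q => f p.1 p.2) {N : ℕ} (hN : 1 ≤ N)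
    (hsol : Measurable fun q : Fin N → Q => scenarioSolution c Θ f q) (M : ℕ) {ε : ℝ}
    (hε : ε ≤ 1) :
    ((Measure.pi fun _ : Fin N => μ).prod (Measure.pi fun _ : Fin M => μ)).real
      ({p | (feasibleSet Θ f p.1).Nonempty ∧
        ∀ i, violationIndicator f (scenarioSolution c Θ f p.1) (p.2 i) = 0} ∩
        Prod.fst ⁻¹' {q | (feasibleSet Θ f q).Nonempty ∧
          violationProb μ f (scenarioSolution c Θ f q) ∈ Set.Ioi ε}) ≤ (1 - ε) ^ M := by
  have h1ε : 0 ≤ 1 - ε := by linarith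
  refine prod_real_le_of_forall ((measurableSet_feasible_validated huniq hΘ hf hN hsol M).inter
    (measurable_fst
      (measurableSet_feasible_violationProb huniq hΘ μ hf hN hsol measurableSet_Ioi)))
    (by positivity) fun q => ?_
  by_cases hq : (feasibleSet Θ f q).Nonempty ∧
      violationProb μ f (scenarioSolution c Θ f q) ∈ Set.Ioi ε
  · have hA := measurableSet_violation hf ((feasibleSet_nonempty_iff huniq hN).1 hq.1).1
    calc _ ≤ (Measure.pi fun _ : Fin M => μ).real
          (Set.univ.pi fun _ => {q' | 0 < f (scenarioSolution c Θ f q) q'}ᶜ) := by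
          refine measureReal_mono fun g hg i _ => ?_
          have := violationIndicator_eq_zero_iff.1 (hg.1.2 i)
          simpa using this
      _ = μ.real {q' | 0 < f (scenarioSolution c Θ f q) q'}ᶜ ^ M := by
          simp [Measure.real, Measure.pi_pi, ENNReal.toReal_pow]
      _ ≤ (1 - ε) ^ M := by
          refine pow_le_pow_left₀ measureReal_nonneg ?_ M
          rw [probReal_compl_eq_one_sub hA]
          have : ε < μ.real {q' | 0 < f (scenarioSolution c Θ f q) q'} := hq.2
          linarith
  · refine le_trans (le_of_eq ?_) (pow_nonneg h1ε M)
    rw [show Prod.mk q ⁻¹' _ = (∅ : Set (Fin M → Q)) from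
      Set.eq_empty_of_forall_notMem fun g hg => hq hg.2, measureReal_empty]

/-- The budget `δ / 2` is shared among the iterations in proportion to `k ^ (-α)`; the sample bound
is the logarithm of this. -/
lemma pow_le_of_validationBound_le {ε δ α : ℝ} (hε : ε ∈ Set.Ioo (0 : ℝ) 1) (hδ : 0 < δ) {kt : ℕ}
    (hkt : 1 < kt) {k M : ℕ} (hk : 1 ≤ k) (hM : validationBound ε δ α kt k ≤ M) :
    (1 - ε) ^ M ≤ (k : ℝ) ^ (-α) * (δ / 2 / pSeries (kt - 1) α) := by
  have h1 : 0 < 1 - ε := by linarith [hε.2]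
  have hL : 0 < Real.log (1 / (1 - ε)) :=
    Real.log_pos (by rw [lt_div_iff₀ h1]; linarith [hε.1])
  have hk' : (0 : ℝ) < k := by exact_mod_cast hk
  have hS : 0 < pSeries (kt - 1) α := by
    refine Finset.sum_pos (fun j hj => Real.rpow_pos_of_pos ?_ _)
      ⟨1, Finset.mem_Icc.2 ⟨le_rfl, by omega⟩⟩
    exact_mod_cast (Finset.mem_Icc.1 hj).1
  rw [validationBound, div_le_iff₀ hL] at hM
  have hpos : 0 < (k : ℝ) ^ (-α) * (δ / 2 / pSeries (kt - 1) α) := by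
    have := Real.rpow_pos_of_pos hk' (-α)
    positivity
  rw [← Real.log_le_log_iff (pow_pos h1 M) hpos, Real.log_pow,
    Real.log_mul (Real.rpow_pos_of_pos hk' _).ne' (by positivity), Real.log_rpow hk',
    Real.log_div (by positivity) hS.ne']
  rw [one_div, Real.log_inv] at hM
  have h2 : Real.log (δ / 2) = -Real.log (2 / δ) := by rw [← Real.log_inv, inv_div]
  rw [h2]
  linarith

lemma sum_pow_le_of_validationBound_le {ε δ α : ℝ} (hε : ε ∈ Set.Ioo (0 : ℝ) 1) (hδ : 0 < δ)
    {kt : ℕ} (hkt : 1 < kt) {Mk : ℕ → ℕ}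
    (hMk : ∀ k, 1 ≤ k → k < kt → validationBound ε δ α kt k ≤ (Mk k : ℝ)) :
    ∑ k ∈ Finset.Ico 1 kt, (1 - ε) ^ Mk k ≤ δ / 2 := by
  have hS : 0 < pSeries (kt - 1) α := by
    refine Finset.sum_pos (fun j hj => Real.rpow_pos_of_pos ?_ _)
      ⟨1, Finset.mem_Icc.2 ⟨le_rfl, by omega⟩⟩
    exact_mod_cast (Finset.mem_Icc.1 hj).1
  calc _ ≤ ∑ k ∈ Finset.Ico 1 kt, (k : ℝ) ^ (-α) * (δ / 2 / pSeries (kt - 1) α) :=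
        Finset.sum_le_sum fun k hk => by
          rw [Finset.mem_Ico] at hk
          exact pow_le_of_validationBound_le hε hδ hkt hk.1 (hMk k hk.1 hk.2)
    _ = pSeries (kt - 1) α * (δ / 2 / pSeries (kt - 1) α) := by
        rw [← Finset.sum_mul, pSeries]
        have hIco : Finset.Ico 1 kt = Finset.Icc 1 (kt - 1) := by
          ext k
          simp only [Finset.mem_Ico, Finset.mem_Icc]
          omega
        rw [hIco]
    _ = δ / 2 := mul_div_cancel₀ _ hS.ne'

end Validation

/-! ### Induction over the iterations -/

section Algorithm

variable {n : ℕ} {Q Ω : Type*} {c : Vec n} {Θ : Set (Vec n)} {f : Vec n → Q → ℝ}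

/-- One step of the recursion, seen on the good event. Infeasibility makes it vacuous, and the two
kinds of exit merge into one case. -/
lemma forall_runFrom_exit_iff {kt : ℕ} {Nk Mk : ℕ → ℕ} {qd : ∀ k, Fin (Nk k) → Q}
    {qv : ∀ k, Fin (Mk k) → Q} {k : ℕ} {p : Vec n → Prop} :
    (∀ k' θ, runFrom c Θ f kt qd qv k = .exit k' θ → p θ) ↔
      ((feasibleSet Θ f (qd k)).Nonempty →
        if kt ≤ k ∨ ∀ i, violationIndicator f (scenarioSolution c Θ f (qd k)) (qv k i) = 0 then
          p (scenarioSolution c Θ f (qd k))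
        else ∀ k' θ, runFrom c Θ f kt qd qv (k + 1) = .exit k' θ → p θ) := by
  rw [runFrom]
  by_cases h1 : (feasibleSet Θ f (qd k)).Nonempty
  · by_cases h2 : kt ≤ k
    · simp [h1, h2]
    · by_cases h3 : ∀ i, violationIndicator f (scenarioSolution c Θ f (qd k)) (qv k i) = 0
      · simp only [h1, h2, h3, not_true_eq_false, if_false, if_true, forall_const, implies_true,
          or_true, Outcome.exit.injEq, and_imp]
        exact ⟨fun h => h _ _ rfl rfl, fun h _ _ _ h' => h' ▸ h⟩
      · simp only [h1, h2, h3, not_true_eq_false, if_false, forall_const, or_self]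
  · simp [h1]

variable [MeasurableSpace Q] [MeasurableSpace Ω]

/-- The run from iteration `k` on exits with a solution that violates the constraints with
probability above `ε` at most with the probability that this happens at the last iteration or
that some such solution is validated before. -/
lemma measurable_and_real_runFrom_le (μ : Measure Q) [IsProbabilityMeasure μ] (P : Measure Ω)
    [IsProbabilityMeasure P] (hconv : ConvexityAssumption Θ f)
    (huniq : UniquenessAssumption c Θ f) (hf : Measurable fun p : Θ × Q => f p.1 p.2)
    (hsol : ∀ N : ℕ, Measurable fun q : Fin N → Q => scenarioSolution c Θ f q)
    {ε : ℝ} (h0 : 0 < ε) (h1 : ε < 1) {kt : ℕ} {Nk Mk : ℕ → ℕ}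
    (hNk : ∀ k, 1 ≤ k → k ≤ kt → 1 ≤ Nk k) {X : Draw Nk Mk → Ω → Q}
    (hX : ∀ s, Measurable (X s)) (hlaw : ∀ s, P.map (X s) = μ) (hindep : iIndepFun X P)
    (j k : ℕ) (hk : 1 ≤ k) (hjk : k + j = kt) :
    MeasurableSet {ω | ∀ k' θ, runFrom c Θ f kt (fun k (i : Fin (Nk k)) => X ⟨k, .inl i⟩ ω)
        (fun k (i : Fin (Mk k)) => X ⟨k, .inr i⟩ ω) k = .exit k' θ →
          violationProb μ f θ ≤ ε} ∧
      P.real {ω | ∀ k' θ, runFrom c Θ f kt (fun k (i : Fin (Nk k)) => X ⟨k, .inl i⟩ ω)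
        (fun k (i : Fin (Mk k)) => X ⟨k, .inr i⟩ ω) k = .exit k' θ →
          violationProb μ f θ ≤ ε}ᶜ ≤
        binomialTail n (Nk kt) ε + ∑ k ∈ Finset.Ico k kt, (1 - ε) ^ Mk k := by
  have hΘ := hconv.2.1.measurableSet
  have hNk1 := hNk k hk (by omega)
  have hdm : Measurable fun ω (i : Fin (Nk k)) => X ⟨k, .inl i⟩ ω :=
    measurable_pi_lambda _ fun i => hX _
  have hpm : Measurable fun ω => ((fun i => X ⟨k, .inl i⟩ ω, fun i => X ⟨k, .inr i⟩ ω) :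
      (Fin (Nk k) → Q) × (Fin (Mk k) → Q)) :=
    hdm.prodMk (measurable_pi_lambda _ fun i => hX _)
  have hFm := measurableSet_feasible huniq hΘ hf hNk1 (hsol _)
  have hWm := measurableSet_feasible_violationProb huniq hΘ μ hf hNk1 (hsol _)
    (measurableSet_Iic (a := ε))
  have hBm := measurableSet_feasible_violationProb huniq hΘ μ hf hNk1 (hsol _)
    (measurableSet_Ioi (a := ε))
  have hLm := measurableSet_feasible_validated huniq hΘ hf hNk1 (hsol _) (Mk k)
  induction j generalizing k with
  | zero =>
    obtain rfl : k = kt := by omega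
    have hmem : ∀ ω, (∀ k' θ, runFrom c Θ f k (fun k (i : Fin (Nk k)) => X ⟨k, .inl i⟩ ω)
        (fun k (i : Fin (Mk k)) => X ⟨k, .inr i⟩ ω) k = .exit k' θ →
          violationProb μ f θ ≤ ε) ↔ _ := fun ω => forall_runFrom_exit_iff
    simp only [le_refl, true_or, if_true] at hmem
    simp only [hmem]
    constructor
    · convert! (hdm hFm).compl.union (hdm hWm) using 1
      ext ω
      simp only [Set.mem_ofPred_eq, Set.mem_union, Set.mem_compl_iff, Set.mem_preimage,
        Set.mem_Iic]
      tauto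
    · rw [Finset.Ico_self, Finset.sum_empty, add_zero]
      refine le_trans (le_of_eq ?_)
        (pi_real_violation_le_binomialTail hconv huniq μ hf hNk1 (hsol _) h0 h1)
      rw [← map_eq_pi (e := fun i => (⟨k, .inl i⟩ : Draw Nk Mk)) hX hlaw hindep
        (fun a b h => by simpa using h), map_measureReal_apply hdm hBm]
      congr 1
      ext ω
      simp only [Set.mem_ofPred_eq, Set.mem_compl_iff, Set.mem_preimage, Set.mem_Ioi,
        Classical.not_imp, not_le]
  | succ j ih =>
    have hk1 := hNk (k + 1) (by omega) (by omega)
    have hdm' : Measurable fun ω (i : Fin (Nk (k + 1))) => X ⟨k + 1, .inl i⟩ ω :=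
      measurable_pi_lambda _ fun i => hX _
    obtain ⟨ihm, ihP⟩ := ih (k + 1) (by omega) (by omega) hk1 hdm'
      (hdm'.prodMk (measurable_pi_lambda _ fun i => hX _))
      (measurableSet_feasible huniq hΘ hf hk1 (hsol _))
      (measurableSet_feasible_violationProb huniq hΘ μ hf hk1 (hsol _) measurableSet_Iic)
      (measurableSet_feasible_violationProb huniq hΘ μ hf hk1 (hsol _) measurableSet_Ioi)
      (measurableSet_feasible_validated huniq hΘ hf hk1 (hsol _) (Mk (k + 1)))
    set A := {ω | ∀ k' θ, runFrom c Θ f kt (fun k (i : Fin (Nk k)) => X ⟨k, .inl i⟩ ω)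
        (fun k (i : Fin (Mk k)) => X ⟨k, .inr i⟩ ω) (k + 1) = .exit k' θ →
          violationProb μ f θ ≤ ε} with hA
    have hkt : ¬ kt ≤ k := by omega
    have hmem : ∀ ω, (∀ k' θ, runFrom c Θ f kt (fun k (i : Fin (Nk k)) => X ⟨k, .inl i⟩ ω)
        (fun k (i : Fin (Mk k)) => X ⟨k, .inr i⟩ ω) k = .exit k' θ →
          violationProb μ f θ ≤ ε) ↔ _ := fun ω => forall_runFrom_exit_iff
    simp only [hkt, false_or] at hmem
    simp only [hmem]
    constructor
    · convert! ((hdm hFm).compl.union ((hpm hLm).inter (hdm hWm))).union ((hpm hLm).compl.inter ihm)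
        using 1
      ext ω
      simp only [Set.mem_ofPred_eq, Set.mem_union, Set.mem_inter_iff, Set.mem_compl_iff,
        Set.mem_preimage, Set.mem_Iic, hA]
      split_ifs <;> tauto
    · rw [Finset.sum_eq_sum_Ico_succ_bot (by omega : k < kt), add_left_comm]
      have hval := prod_real_validated_le huniq hΘ μ hf hNk1 (hsol _) (Mk k) h1.le
      rw [← map_eq_prod_pi (e := fun s => (⟨k, s⟩ : Draw Nk Mk)) hX hlaw hindep
        (fun a b h => by simpa using h),
        map_measureReal_apply hpm (hLm.inter (measurable_fst hBm))] at hval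
      -- A bad run either validates a bad solution at iteration `k` or is bad from iteration `k + 1`
      -- on.
      refine le_trans (measureReal_mono fun ω hω => ?_)
        ((measureReal_union_le _ _).trans (add_le_add hval ihP))
      simp only [Set.mem_ofPred_eq, Set.mem_union, Set.mem_inter_iff, Set.mem_compl_iff,
        Set.mem_preimage, Set.mem_Ioi, hA, ← not_le] at hω ⊢
      split_ifs at hω <;> tauto

end Algorithm

end SeqScenario

end

/-! ### Conclusion -/

theorem theorem1 {n : ℕ} {Q Ω : Type*} [MeasurableSpace Q] [MeasurableSpace Ω]
    (μ : Measure Q) [IsProbabilityMeasure μ] (P : Measure Ω) [IsProbabilityMeasure P]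
    -- the uncertain convex problem
    (c : SeqScenario.Vec n) (Θ : Set (SeqScenario.Vec n)) (f : SeqScenario.Vec n → Q → ℝ)
    (hconv : SeqScenario.ConvexityAssumption Θ f)
    (huniq : SeqScenario.UniquenessAssumption c Θ f)
    -- measurability: `f` on `Θ × Q`, and the solutions of the scenario problems
    (hf : Measurable (fun p : Θ × Q => f p.1 p.2))
    (hsol : ∀ N : ℕ, Measurable (fun q : Fin N → Q => SeqScenario.scenarioSolution c Θ f q))
    -- parameters of the algorithm
    (ε δ α : ℝ) (hε : ε ∈ Set.Ioo (0 : ℝ) 1) (hδ : δ ∈ Set.Ioo (0 : ℝ) 1) (hα : 0 < α)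
    (kt : ℕ) (hkt : 1 < kt)
    (N : ℕ) (hN : IsLeast {m : ℕ | SeqScenario.binomialTail n m ε ≤ δ / 2} N)
    (Nk Mk : ℕ → ℕ)
    (hNk : ∀ k, 1 ≤ k → k ≤ kt → (N : ℝ) * ((k : ℝ) / (kt : ℝ)) ≤ (Nk k : ℝ))
    (hMk : ∀ k, 1 ≤ k → k < kt → SeqScenario.validationBound ε δ α kt k ≤ (Mk k : ℝ))
    -- all design and validation samples are i.i.d. with law `μ`
    (X : SeqScenario.Draw Nk Mk → Ω → Q)
    (hX : ∀ s, Measurable (X s)) (hlaw : ∀ s, P.map (X s) = μ) (hindep : iIndepFun X P) :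
    MeasurableSet {ω | ∀ (k : ℕ) (θsol : SeqScenario.Vec n),
        SeqScenario.algorithmOutcome c Θ f kt X ω = .exit k θsol →
          SeqScenario.violationProb μ f θsol ≤ ε} ∧
      1 - δ ≤ P.real {ω | ∀ (k : ℕ) (θsol : SeqScenario.Vec n),
        SeqScenario.algorithmOutcome c Θ f kt X ω = .exit k θsol →
          SeqScenario.violationProb μ f θsol ≤ ε} := by
  have hsmall : SeqScenario.binomialTail n N ε ≤ δ / 2 := hN.1
  -- With no samples the tail is `1 > δ / 2`. Hence `N > 0`, and every design set is nonempty, as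
  -- the uniqueness assumption requires.
  have hNpos : 0 < N := by
    rcases Nat.eq_zero_or_pos N with h | h
    · rw [h, SeqScenario.binomialTail_eq_one (Nat.zero_le n)] at hsmall
      linarith [hδ.2]
    · exact h
  have hkt0 : (0 : ℝ) < kt := by exact_mod_cast (by omega : 0 < kt)
  have hNk1 : ∀ k, 1 ≤ k → k ≤ kt → 1 ≤ Nk k := by
    intro k hk hk'
    have h1 : (0 : ℝ) < N * ((k : ℝ) / kt) := by positivity
    exact_mod_cast h1.trans_le (hNk k hk hk')
  have hlast : N ≤ Nk kt := by
    have h := hNk kt hkt.le le_rfl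
    rw [div_self hkt0.ne', mul_one] at h
    exact_mod_cast h
  obtain ⟨hm, hP⟩ := SeqScenario.measurable_and_real_runFrom_le μ P hconv huniq hf hsol hε.1 hε.2
    hNk1 hX hlaw hindep (kt - 1) 1 le_rfl (by omega)
  refine ⟨hm, ?_⟩
  rw [probReal_compl_eq_one_sub hm] at hP
  have h1 := SeqScenario.binomialTail_antitone n hε.1.le hε.2.le hlast
  have h2 := SeqScenario.sum_pow_le_of_validationBound_le hε hδ.1 hkt hMk
  change SeqScenario.binomialTail n (Nk kt) ε ≤ SeqScenario.binomialTail n N ε at h1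
  change 1 - δ ≤ P.real _
  have h3 : 1 - δ ≤ 1 - (SeqScenario.binomialTail n (Nk kt) ε +
    ∑ k ∈ Finset.Ico 1 kt, (1 - ε) ^ Mk k) := by linarith
  refine h3.trans ?_
  rw [sub_le_comm]
  exact hP
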